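/- Let $n\in\{2,3\}$ and let $\Omega\subset\mathbb R^n$ be a bounded, nonempty, open, convex set. Put $V_0=H^1_0(\Omega)$ with the $H^1$-norm and dual space $V_0^*$, and for $c\in\mathbb R$ let $W_c$ be the set of symmetric matrix fields $\mu\in[H^1(\Omega)]^{n\times n}$ with $\mu\nu\cdot\nu=c$ on $\partial\Omega$ in the sense of traces, where $\nu$ is the unit outward normal. Write $(\cdot,\cdot)$ for the $L^2(\Omega)$ inner products and $\operatorname{div}$ for the row-wise divergence. Let $\varepsilon>0$, let $f\in L^2(\Omega)$ with $f>0$ a.e. in $\Omega$, let $g$ be a function on $\partial\Omega$, and let $u^\varepsilon$ be a strictly convex weak solution of $$-\varepsilon\Delta^2u^\varepsilon+\det D^2u^\varepsilon=f\ \text{ in }\Omega,\qquad u^\varepsilon=g,\quad D^2u^\varepsilon\,\nu\cdot\nu=\varepsilon\ \text{ on }\partial\Omega,$$ that is, $u^\varepsilon\in H^1(\Omega)$ has trace $g$ and a strictly convex representative on $\Omega$, its weak Hessian $\sigma^\varepsilon=D^2u^\varepsilon$ belongs to $W_\varepsilon$, and $\varepsilon(\operatorname{div}\sigma^\varepsilon,Dv)+(\det\sigma^\varepsilon,v)=(f,v)$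 for all $v\in V_0$. Let $\Phi^\varepsilon=\operatorname{cof}(D^2u^\varepsilon)$ be the cofactor matrix of the Hessian. Let $T_h$ be a finite conforming partition of $\overline\Omega$ either into closed nondegenerate simplices (triangles if $n=2$, tetrahedra if $n=3$), or into closed nondegenerate rectangles (boxes) with sides parallel to the coordinate axes. Let $k\ge2$ and let $V^h\subset H^1(\Omega)$ be the Lagrange finite element space of functions that are continuous on $\overline\Omega$ and coincide on each cell of $T_h$ with a polynomial of degree at most $k$ (total degree on simplices, degree in each variable on rectangles). Put $V_0^h=V^h\cap V_0$ and $W_0^h=[V^h]^{n\times n}\cap W_0$. Then for every $q\in V_0^*$ there is exactly one pair $(\chi_h,w_h)\in W_0^h\times V_0^h$ such that $$(\chi_h,\mu_h)+(\operatorname{div}\mu_h,Dw_h)=0\qquad\text{for all }\mu_h\in W_0^h,$$ $$(\operatorname{div}\chi_h,Dv_h)-\frac1\varepsilon(\Phi^\varepsilon Dw_h,Dv_h)=\langle q,v_h\rangle\qquad\text{for all }v_h\in V_0^h.$$ -/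

import Mathlib

open MeasureTheory Filter Topology
open scoped ContDiff ENNReal

noncomputable section

namespace MongeAmpereFEM

/-- Euclidean space `ℝⁿ`. -/
abbrev Rn (n : ℕ) : Type := EuclideanSpace ℝ (Fin n)

/-- The partial derivative `∂φ/∂xᵢ` of a (smooth) function. -/
def partialDeriv {n : ℕ} (i : Fin n) (φ : Rn n → ℝ) (x : Rn n) : ℝ :=
  fderiv ℝ φ x (EuclideanSpace.single i 1)

/-- `φ ∈ C_c^∞(Ω)`. -/
structure IsTest {n : ℕ} (Ω : Set (Rn n)) (φ : Rn n → ℝ) : Prop where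
  smooth : ContDiff ℝ ∞ φ
  compact : HasCompactSupport φ
  supp : tsupport φ ⊆ Ω

/-- Lebesgue measure on `Ω`. -/
abbrev vol {n : ℕ} (Ω : Set (Rn n)) : Measure (Rn n) := volume.restrict Ω

/-- `L²(Ω) × L²(Ω)ⁿ` with the Hilbert norm `(‖u‖² + ‖p‖²)^{1/2}`; it is the ambient space of
`H¹(Ω)`, whose elements are stored as pairs `(u, Du)`. -/
abbrev L2Pair {n : ℕ} (Ω : Set (Rn n)) : Type :=
  WithLp 2 (Lp ℝ 2 (vol Ω) × Lp (Rn n) 2 (vol Ω))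

theorem IsTest.memLp_partialDeriv {n : ℕ} {Ω : Set (Rn n)} {φ : Rn n → ℝ} (h : IsTest Ω φ)
    (i : Fin n) : MemLp (partialDeriv i φ) 2 (vol Ω) := by
  have hc : Continuous (partialDeriv i φ) :=
    (h.smooth.continuous_fderiv (by simp)).clm_apply continuous_const
  exact hc.memLp_of_hasCompactSupport ((h.compact.fderiv (𝕜 := ℝ)).comp_left
    (g := fun L : Rn n →L[ℝ] ℝ => L (EuclideanSpace.single i 1)) (by simp))

theorem IsTest.memLp {n : ℕ} {Ω : Set (Rn n)} {φ : Rn n → ℝ} (h : IsTest Ω φ) :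
    MemLp φ 2 (vol Ω) :=
  h.smooth.continuous.memLp_of_hasCompactSupport h.compact

theorem memLp_coord {n : ℕ} {Ω : Set (Rn n)} (p : Lp (Rn n) 2 (vol Ω)) (i : Fin n) :
    MemLp (fun x => p x i) 2 (vol Ω) :=
  (Lp.memLp p).continuousLinearMap_comp (EuclideanSpace.proj i : Rn n →L[ℝ] ℝ)

/-- The Sobolev space `H¹(Ω)`: pairs `(u, p)` in `L²(Ω) × L²(Ω)ⁿ` such that `p` is the weak
gradient of `u`. The norm is `(‖u‖²_{L²} + ‖Du‖²_{L²})^{1/2}`. -/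
def H1 {n : ℕ} (Ω : Set (Rn n)) : Submodule ℝ (L2Pair Ω) where
  carrier := {v | ∀ φ, IsTest Ω φ → ∀ i : Fin n,
    ∫ x in Ω, v.fst x * partialDeriv i φ x = -∫ x in Ω, v.snd x i * φ x}
  zero_mem' := by
    intro φ _ i
    have h1 : ∫ x in Ω, (0 : L2Pair Ω).fst x * partialDeriv i φ x = 0 := by
      apply integral_eq_zero_of_ae
      filter_upwards [Lp.coeFn_zero ℝ 2 (vol Ω)] with x hx
      rw [WithLp.zero_fst, hx, Pi.zero_apply, zero_mul]
    have h2 : ∫ x in Ω, (0 : L2Pair Ω).snd x i * φ x = 0 := by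
      apply integral_eq_zero_of_ae
      filter_upwards [Lp.coeFn_zero (Rn n) 2 (vol Ω)] with x hx
      rw [WithLp.zero_snd, hx, Pi.zero_apply, PiLp.zero_apply, zero_mul]; rfl
    rw [h1, h2, neg_zero]
  add_mem' := by
    intro a b ha hb φ hφ i
    have h1 : ∫ x in Ω, (a + b).fst x * partialDeriv i φ x
        = ∫ x in Ω, (a.fst x * partialDeriv i φ x + b.fst x * partialDeriv i φ x) := by
      apply integral_congr_ae
      filter_upwards [Lp.coeFn_add a.fst b.fst] with x hx
      rw [WithLp.add_fst, hx, Pi.add_apply, add_mul]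
    have h2 : ∫ x in Ω, (a + b).snd x i * φ x
        = ∫ x in Ω, (a.snd x i * φ x + b.snd x i * φ x) := by
      apply integral_congr_ae
      filter_upwards [Lp.coeFn_add a.snd b.snd] with x hx
      rw [WithLp.add_snd, hx, Pi.add_apply, PiLp.add_apply, add_mul]
    have i1 (v : L2Pair Ω) : Integrable (fun x => v.fst x * partialDeriv i φ x) (vol Ω) :=
      (Lp.memLp v.fst).integrable_mul (hφ.memLp_partialDeriv i)
    have i2 (v : L2Pair Ω) : Integrable (fun x => v.snd x i * φ x) (vol Ω) :=
      (memLp_coord v.snd i).integrable_mul hφ.memLp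
    rw [h1, h2, integral_add (i1 a) (i1 b), integral_add (i2 a) (i2 b), ha φ hφ i, hb φ hφ i]
    ring
  smul_mem' := by
    intro c a ha φ hφ i
    have h1 : ∫ x in Ω, (c • a).fst x * partialDeriv i φ x
        = ∫ x in Ω, c * (a.fst x * partialDeriv i φ x) := by
      apply integral_congr_ae
      filter_upwards [Lp.coeFn_smul c a.fst] with x hx
      rw [WithLp.smul_fst, hx, Pi.smul_apply, smul_eq_mul, mul_assoc]
    have h2 : ∫ x in Ω, (c • a).snd x i * φ x = ∫ x in Ω, c * (a.snd x i * φ x) := by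
      apply integral_congr_ae
      filter_upwards [Lp.coeFn_smul c a.snd] with x hx
      rw [WithLp.smul_snd, hx, Pi.smul_apply, PiLp.smul_apply, smul_eq_mul, mul_assoc]
    rw [h1, h2, integral_const_mul, integral_const_mul, ha φ hφ i, mul_neg]

/-- The values of an element of `H¹(Ω)` (defined up to null sets). -/
def val {n : ℕ} {Ω : Set (Rn n)} (v : H1 Ω) (x : Rn n) : ℝ := v.1.fst x

/-- The weak gradient `Dv` of an element of `H¹(Ω)` (defined up to null sets). -/
def grad {n : ℕ} {Ω : Set (Rn n)} (v : H1 Ω) (x : Rn n) : Rn n := v.1.snd x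

/-- `H¹₀(Ω)`, the closure of `C_c^∞(Ω)` in `H¹(Ω)`. This is the space `V₀`; its dual
`V₀*` is `StrongDual ℝ (H10 Ω)`. -/
def H10 {n : ℕ} (Ω : Set (Rn n)) : Submodule ℝ (H1 Ω) :=
  (Submodule.span ℝ {v : H1 Ω | ∃ φ, IsTest Ω φ ∧ val v =ᵐ[vol Ω] φ}).topologicalClosure

/-- Surface measure on `∂Ω`: the `(n-1)`-dimensional Hausdorff measure. -/
def surf {n : ℕ} (Ω : Set (Rn n)) : Measure (Rn n) :=
  (Measure.hausdorffMeasure ((n : ℝ) - 1)).restrict (frontier Ω)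

/-- `γ ∈ L²(∂Ω)` is the trace of `v ∈ H¹(Ω)` on `∂Ω`: there are functions smooth up to the
boundary which converge to `v` in `H¹(Ω)` and whose restrictions to `∂Ω` converge to `γ` in
`L²(∂Ω)`. -/
def HasTrace {n : ℕ} {Ω : Set (Rn n)} (v : H1 Ω) (γ : Rn n → ℝ) : Prop :=
  MemLp γ 2 (surf Ω) ∧
  ∃ (φ : ℕ → Rn n → ℝ) (V : ℕ → H1 Ω),
    (∀ m, ContDiff ℝ ∞ (φ m)) ∧
    (∀ m, val (V m) =ᵐ[vol Ω] φ m) ∧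
    Tendsto V atTop (𝓝 v) ∧
    Tendsto (fun m => eLpNorm (φ m - γ) 2 (surf Ω)) atTop (𝓝 0)

/-- `ν` is a unit outward normal at `x ∈ ∂Ω` for a convex set `Ω` (at almost every boundary
point there is exactly one). -/
def IsOutwardNormal {n : ℕ} (Ω : Set (Rn n)) (x ν : Rn n) : Prop :=
  ‖ν‖ = 1 ∧ ∀ y ∈ Ω, inner ℝ ν (y - x) ≤ 0

/-- The space `W_c` of symmetric matrix fields `μ ∈ [H¹(Ω)]^{n×n}` with `μν·ν = c` on `∂Ω`
in the sense of traces. -/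
def W {n : ℕ} (Ω : Set (Rn n)) (c : ℝ) : Set (Matrix (Fin n) (Fin n) (H1 Ω)) :=
  {μ | μ.IsSymm ∧ ∃ γ : Fin n → Fin n → Rn n → ℝ, (∀ i j, HasTrace (μ i j) (γ i j)) ∧
    ∀ᵐ x ∂(surf Ω), ∀ ν, IsOutwardNormal Ω x ν → ∑ i, ∑ j, γ i j x * ν j * ν i = c}

/-- The pointwise value of a matrix field. -/
def matVal {n : ℕ} {Ω : Set (Rn n)} (μ : Matrix (Fin n) (Fin n) (H1 Ω)) (x : Rn n) :
    Matrix (Fin n) (Fin n) ℝ :=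
  Matrix.of fun i j => val (μ i j) x

/-- The (row-wise) divergence of a matrix field. -/
def matDiv {n : ℕ} {Ω : Set (Rn n)} (μ : Matrix (Fin n) (Fin n) (H1 Ω)) (x : Rn n)
    (i : Fin n) : ℝ :=
  ∑ j, grad (μ i j) x j

/-- The `L²` inner product `(χ, μ) = ∫_Ω χ : μ`. -/
def matInner {n : ℕ} {Ω : Set (Rn n)} (χ μ : Matrix (Fin n) (Fin n) (H1 Ω)) : ℝ :=
  ∫ x in Ω, ∑ i, ∑ j, val (χ i j) x * val (μ i j) x

/-- `(div μ, Dv) = ∫_Ω div μ · Dv`. -/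
def divInner {n : ℕ} {Ω : Set (Rn n)} (μ : Matrix (Fin n) (Fin n) (H1 Ω)) (v : H1 Ω) : ℝ :=
  ∫ x in Ω, ∑ i, matDiv μ x i * grad v x i

/-- `(A Dw, Dv) = ∫_Ω A Dw · Dv` for a matrix-valued coefficient `A`. -/
def coeffInner {n : ℕ} {Ω : Set (Rn n)} (A : Rn n → Matrix (Fin n) (Fin n) ℝ) (w v : H1 Ω) : ℝ :=
  ∫ x in Ω, ∑ i, ∑ j, A x i j * grad w x j * grad v x i

/-- `σ = D²u` in the weak sense. -/
def IsWeakHessian {n : ℕ} {Ω : Set (Rn n)} (u : H1 Ω) (σ : Matrix (Fin n) (Fin n) (H1 Ω)) : Prop :=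
  ∀ φ, IsTest Ω φ → ∀ i j : Fin n,
    ∫ x in Ω, grad u x i * partialDeriv j φ x = -∫ x in Ω, val (σ i j) x * φ x

/-- `u`, with Hessian `σ = D²u ∈ [H¹(Ω)]^{n×n}`, is a strictly convex weak solution of
`-ε Δ²u + det D²u = f` in `Ω`, `u = g` and `D²u ν·ν = ε` on `∂Ω`. -/
structure IsStrictlyConvexSolution {n : ℕ} (Ω : Set (Rn n)) (ε : ℝ) (f g : Rn n → ℝ)
    (u : H1 Ω) (σ : Matrix (Fin n) (Fin n) (H1 Ω)) : Prop where
  hessian : IsWeakHessian u σ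
  boundary_val : HasTrace u g
  boundary_hess : σ ∈ W Ω ε
  equation : ∀ v ∈ H10 Ω,
    ε * divInner σ v + ∫ x in Ω, (matVal σ x).det * val v x = ∫ x in Ω, f x * val v x
  strictConvex : ∃ u' : Rn n → ℝ, val u =ᵐ[vol Ω] u' ∧ StrictConvexOn ℝ Ω u'

/-- The cofactor matrix field `Φ = cof(σ)`. -/
def cof {n : ℕ} {Ω : Set (Rn n)} (σ : Matrix (Fin n) (Fin n) (H1 Ω)) (x : Rn n) :
    Matrix (Fin n) (Fin n) ℝ :=
  (matVal σ x).adjugate.transpose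

/-- The two types of meshes: triangles/tetrahedra, or rectangles/3-D rectangles. -/
inductive MeshKind
  | simplicial
  | rectangular

/-- `K` is a nondegenerate closed mesh cell: an `n`-simplex, or an `n`-dimensional rectangle
with sides parallel to the coordinate axes. -/
def IsCell {n : ℕ} : MeshKind → Set (Rn n) → Prop
  | .simplicial, K => ∃ s : Affine.Simplex ℝ (Rn n) n, K = convexHull ℝ (Set.range s.points)
  | .rectangular, K => ∃ a b : Fin n → ℝ, (∀ i, a i < b i) ∧
      K = {x | ∀ i, a i ≤ x i ∧ x i ≤ b i}

/-- The local polynomials: total degree `≤ k` on simplices, degree `≤ k` in each variable on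
rectangles. -/
def localPoly (n k : ℕ) : MeshKind → Submodule ℝ (MvPolynomial (Fin n) ℝ)
  | .simplicial => MvPolynomial.restrictTotalDegree (Fin n) ℝ k
  | .rectangular => MvPolynomial.restrictDegree (Fin n) ℝ k

/-- `T` is a conforming partition of `Ω` into cells of the given kind: the cells cover the closure
of `Ω`, have disjoint interiors, and two distinct cells meet in a common face (possibly empty). -/
structure IsMesh {n : ℕ} (kind : MeshKind) (Ω : Set (Rn n)) (T : Finset (Set (Rn n))) : Prop where
  cell : ∀ K ∈ T, IsCell kind K
  cover : ⋃ K ∈ T, K = closure Ω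
  disjoint_interior : ∀ K ∈ T, ∀ K' ∈ T, K ≠ K' → Disjoint (interior K) (interior K')
  conforming : ∀ K ∈ T, ∀ K' ∈ T, K ≠ K' → IsExposed ℝ K (K ∩ K')

/-- The Lagrange finite element space `V^h ⊂ H¹(Ω)` of continuous piecewise polynomials of
degree `k` on the mesh `T`. -/
def Vh {n : ℕ} (kind : MeshKind) (Ω : Set (Rn n)) (T : Finset (Set (Rn n))) (k : ℕ) :
    Set (H1 Ω) :=
  {v | ∃ v' : Rn n → ℝ, val v =ᵐ[vol Ω] v' ∧ ContinuousOn v' (closure Ω) ∧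
    ∀ K ∈ T, ∃ p ∈ localPoly n k kind, ∀ x ∈ K, v' x = MvPolynomial.eval (fun i => x i) p}

/-- `V₀^h = V^h ∩ V₀`. -/
def V0h {n : ℕ} (kind : MeshKind) (Ω : Set (Rn n)) (T : Finset (Set (Rn n))) (k : ℕ) :
    Set (H1 Ω) :=
  Vh kind Ω T k ∩ (H10 Ω : Set (H1 Ω))

/-- `W₀^h = [V^h]^{n×n} ∩ W₀`. -/
def W0h {n : ℕ} (kind : MeshKind) (Ω : Set (Rn n)) (T : Finset (Set (Rn n))) (k : ℕ) :
    Set (Matrix (Fin n) (Fin n) (H1 Ω)) :=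
  {μ | ∀ i j, μ i j ∈ Vh kind Ω T k} ∩ W Ω 0

/-- `(χ, w) ∈ W₀^h × V₀^h` solves the discrete mixed linearized problem
`(χ, μ) + (div μ, Dw) = 0` for all `μ ∈ W₀^h`,
`(div χ, Dv) - ε⁻¹ (Φ Dw, Dv) = ⟨q, v⟩` for all `v ∈ V₀^h`. -/
structure IsDiscreteSolution {n : ℕ} (kind : MeshKind) (Ω : Set (Rn n))
    (T : Finset (Set (Rn n))) (k : ℕ) (ε : ℝ) (Φ : Rn n → Matrix (Fin n) (Fin n) ℝ)
    (q : StrongDual ℝ (H10 Ω)) (χ : Matrix (Fin n) (Fin n) (H1 Ω)) (w : H1 Ω) : Prop where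
  χ_mem : χ ∈ W0h kind Ω T k
  w_mem : w ∈ V0h kind Ω T k
  eq_moment : ∀ μ ∈ W0h kind Ω T k, matInner χ μ + divInner μ w = 0
  eq_primal : ∀ v, ∀ hv : v ∈ V0h kind Ω T k,
    divInner χ v - (1 / ε) * coeffInner Φ w v = q ⟨v, hv.2⟩

end MongeAmpereFEM

end

open MongeAmpereFEM

/-!
The discrete problem is a saddle point problem on the spaces `W₀^h × V₀^h`, which are finite
dimensional because an element of `H¹` is determined by its values and a finite element function by
finitely many local polynomials (`finite_VhSpace`). It is therefore a square linear system, and it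
suffices that the homogeneous problem has only the zero solution (`existsUnique_saddlePoint`).

Testing the homogeneous problem with its own solution `(χ, w)` gives
`(χ, χ) + ε⁻¹ (Φ Dw, Dw) = 0`. The Hessian of the convex function `u` is positive semidefinite
almost everywhere (`hessian_nonneg`), hence so is its cofactor matrix `Φ` (`cof_nonneg`), and
`χ = 0`. What remains is `(div μ, Dw) = 0` for all `μ ∈ W₀^h`. The isotropic field `μ = w I` is
admissible, since `w` has trace zero (`scalar_mem_W`), and its divergence is `Dw`; so `Dw = 0`, and
`w = 0` because `w ∈ H¹₀` (`eq_zero_of_mem_H10_of_grad`). Semidefiniteness of `Φ` is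
enough for this.

The entries of `Φ` are products of at most two `H¹` functions and only their integrability is used
(`integrable_cof`). The form `(Φ Dw, Dv)` is bilinear on `V₀^h` because finite element functions
have bounded gradients (`exists_bound_grad`).
-/

open scoped ContDiff ENNReal

namespace MongeAmpereFEM

variable {n : ℕ} {Ω : Set (Rn n)}

/-! ### Test functions -/

theorem IsTest.continuous {φ : Rn n → ℝ} (h : IsTest Ω φ) : Continuous φ :=
  h.smooth.continuous

theorem contDiff_partialDeriv {φ : Rn n → ℝ} (h : ContDiff ℝ ∞ φ) (i : Fin n) :
    ContDiff ℝ ∞ (partialDeriv i φ) :=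
  (h.fderiv_right (m := ∞) (by simp)).clm_apply contDiff_const

theorem tsupport_partialDeriv_subset (φ : Rn n → ℝ) (i : Fin n) :
    tsupport (partialDeriv i φ) ⊆ tsupport φ := by
  refine closure_minimal (fun x hx => ?_) (isClosed_tsupport φ)
  by_contra hx'
  have h0 : fderiv ℝ φ x = 0 := by
    by_contra h1
    exact hx' (support_fderiv_subset ℝ h1)
  exact hx (by simp [partialDeriv, h0])

theorem IsTest.partialDeriv {φ : Rn n → ℝ} (h : IsTest Ω φ) (i : Fin n) :
    IsTest Ω (partialDeriv i φ) where
  smooth := contDiff_partialDeriv h.smooth i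
  compact := h.compact.of_isClosed_subset (isClosed_tsupport _) (tsupport_partialDeriv_subset φ i)
  supp := (tsupport_partialDeriv_subset φ i).trans h.supp

theorem IsTest.mul_smooth {φ a : Rn n → ℝ} (h : IsTest Ω φ) (ha : ContDiff ℝ ∞ a) :
    IsTest Ω (a * φ) where
  smooth := ha.mul h.smooth
  compact := h.compact.mul_left
  supp := (tsupport_mul_subset_right (f := a) (g := φ)).trans h.supp

theorem IsTest.zero : IsTest Ω (0 : Rn n → ℝ) where
  smooth := contDiff_const
  compact := HasCompactSupport.zero
  supp := by simp [tsupport]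

theorem IsTest.add {φ ψ : Rn n → ℝ} (h : IsTest Ω φ) (h' : IsTest Ω ψ) : IsTest Ω (φ + ψ) where
  smooth := h.smooth.add h'.smooth
  compact := h.compact.add h'.compact
  supp := (tsupport_add (f := φ) (g := ψ)).trans (Set.union_subset h.supp h'.supp)

theorem IsTest.smul {φ : Rn n → ℝ} (h : IsTest Ω φ) (c : ℝ) : IsTest Ω (c • φ) where
  smooth := contDiff_const.smul h.smooth
  compact := h.compact.smul_left (f := fun _ => c)
  supp := (closure_mono (Function.support_const_smul_subset c φ)).trans h.supp

/-- The fundamental lemma of the calculus of variations on an open set. -/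
theorem ae_eq_zero_of_forall_test (hΩ : IsOpen Ω) {h : Rn n → ℝ} (hh : Integrable h (vol Ω))
    (H : ∀ φ, IsTest Ω φ → ∫ x in Ω, h x * φ x = 0) : h =ᵐ[vol Ω] 0 := by
  have key := hΩ.ae_eq_zero_of_integral_contDiff_smul_eq_zero (μ := volume)
    (IntegrableOn.locallyIntegrableOn hh) (fun φ h1 h2 h3 => by
      rw [← H φ ⟨h1, h2, h3⟩, ← setIntegral_eq_integral_of_forall_compl_eq_zero (s := Ω)]
      · exact integral_congr_ae (ae_of_all _ fun x => by simp [mul_comm])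
      · intro x hx
        rw [image_eq_zero_of_notMem_tsupport (fun hx' => hx (h3 hx')), zero_smul])
  exact (ae_restrict_iff' hΩ.measurableSet).2 key

/-! ### Elements of `H¹` -/

theorem memLp_val (v : H1 Ω) : MemLp (val v) 2 (vol Ω) := Lp.memLp v.1.fst

theorem memLp_grad (v : H1 Ω) (i : Fin n) : MemLp (fun x => grad v x i) 2 (vol Ω) :=
  memLp_coord v.1.snd i

theorem val_zero : val (0 : H1 Ω) =ᵐ[vol Ω] 0 := Lp.coeFn_zero ℝ 2 (vol Ω)

theorem val_add (v w : H1 Ω) : val (v + w) =ᵐ[vol Ω] val v + val w :=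
  Lp.coeFn_add v.1.fst w.1.fst

theorem val_smul (c : ℝ) (v : H1 Ω) : val (c • v) =ᵐ[vol Ω] c • val v :=
  Lp.coeFn_smul c v.1.fst

theorem grad_zero : grad (0 : H1 Ω) =ᵐ[vol Ω] 0 := Lp.coeFn_zero (Rn n) 2 (vol Ω)

theorem grad_add (v w : H1 Ω) : grad (v + w) =ᵐ[vol Ω] grad v + grad w :=
  Lp.coeFn_add v.1.snd w.1.snd

theorem grad_smul (c : ℝ) (v : H1 Ω) : grad (c • v) =ᵐ[vol Ω] c • grad v :=
  Lp.coeFn_smul c v.1.snd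

theorem integral_val_mul_partialDeriv (v : H1 Ω) {φ : Rn n → ℝ} (hφ : IsTest Ω φ) (i : Fin n) :
    ∫ x in Ω, val v x * partialDeriv i φ x = -∫ x in Ω, grad v x i * φ x :=
  v.2 φ hφ i

theorem eq_zero_of_val_grad {v : H1 Ω} (h : val v =ᵐ[vol Ω] 0) (h' : grad v =ᵐ[vol Ω] 0) :
    v = 0 := by
  have h1 : v.1.fst = 0 := (Lp.eq_zero_iff_ae_eq_zero).2 h
  have h2 : v.1.snd = 0 := (Lp.eq_zero_iff_ae_eq_zero).2 h'
  apply Subtype.ext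
  apply WithLp.ofLp_injective
  exact Prod.ext h1 h2

theorem eq_zero_of_val (hΩ : IsOpen Ω) [IsFiniteMeasure (vol Ω)] {v : H1 Ω}
    (h : val v =ᵐ[vol Ω] 0) : v = 0 := by
  refine eq_zero_of_val_grad h ?_
  have key : ∀ i : Fin n, (fun x => grad v x i) =ᵐ[vol Ω] 0 := fun i =>
    ae_eq_zero_of_forall_test hΩ ((memLp_grad v i).integrable (by norm_num)) fun φ hφ => by
      have h1 := integral_val_mul_partialDeriv v hφ i
      have h2 : ∫ x in Ω, val v x * partialDeriv i φ x = 0 := by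
        apply integral_eq_zero_of_ae
        filter_upwards [h] with x hx
        simp [hx]
      linarith
  filter_upwards [ae_all_iff.2 key] with x hx
  ext i
  exact hx i

/-- An element of the span of the test functions is again represented by a test function. -/
theorem exists_test_of_mem_span {v : H1 Ω}
    (hv : v ∈ Submodule.span ℝ {v : H1 Ω | ∃ φ, IsTest Ω φ ∧ val v =ᵐ[vol Ω] φ}) :
    ∃ φ, IsTest Ω φ ∧ val v =ᵐ[vol Ω] φ := by
  induction hv using Submodule.span_induction with
  | mem x h => exact h
  | zero => exact ⟨0, IsTest.zero, val_zero⟩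
  | add x y _ _ hx hy =>
    obtain ⟨φ, h1, h2⟩ := hx
    obtain ⟨ψ, h3, h4⟩ := hy
    exact ⟨φ + ψ, h1.add h3, (val_add x y).trans (h2.add h4)⟩
  | smul c x _ hx =>
    obtain ⟨φ, h1, h2⟩ := hx
    exact ⟨c • φ, h1.smul c, (val_smul c x).trans (h2.const_smul c)⟩

/-- If an element of `H¹` agrees with a smooth function on a set `K`, its weak gradient agrees with
the classical gradient of that function inside `K`. -/
theorem grad_ae_eq_partialDeriv (hΩ : IsOpen Ω) [IsFiniteMeasure (vol Ω)] {v : H1 Ω}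
    {P : Rn n → ℝ} (hP : ContDiff ℝ ∞ P) {K : Set (Rn n)}
    (h : ∀ᵐ x ∂(vol Ω), x ∈ K → val v x = P x) (i : Fin n) :
    ∀ᵐ x ∂(vol Ω), x ∈ interior K → grad v x i = partialDeriv i P x := by
  set O := interior K ∩ Ω with hO
  have hOo : IsOpen O := isOpen_interior.inter hΩ
  have hcP := (contDiff_partialDeriv hP i).continuous
  have hloc : LocallyIntegrableOn (fun x => grad v x i - partialDeriv i P x) O volume := by
    have h1 : IntegrableOn (fun x => grad v x i) Ω volume :=
      (memLp_grad v i).integrable (by norm_num)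
    exact (h1.mono_set Set.inter_subset_right).locallyIntegrableOn.sub
      (hcP.locallyIntegrable.locallyIntegrableOn _)
  have key := hOo.ae_eq_zero_of_integral_contDiff_smul_eq_zero hloc fun ψ h1 h2 h3 => ?_
  · have key' : ∀ᵐ x ∂(vol Ω), x ∈ O → grad v x i - partialDeriv i P x = 0 :=
      ae_restrict_of_ae key
    filter_upwards [key', ae_restrict_mem hΩ.measurableSet] with x hx hxΩ hxK
    exact sub_eq_zero.1 (hx ⟨hxK, hxΩ⟩)
  have hψ : IsTest Ω ψ := ⟨h1, h2, h3.trans Set.inter_subset_right⟩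
  have e1 := integral_val_mul_partialDeriv v hψ i
  have e2 : ∫ x in Ω, val v x * partialDeriv i ψ x = ∫ x in Ω, P x * partialDeriv i ψ x := by
    apply integral_congr_ae
    filter_upwards [h] with x hx
    by_cases hxO : x ∈ O
    · rw [hx (interior_subset hxO.1)]
    · have : partialDeriv i ψ x = 0 := image_eq_zero_of_notMem_tsupport fun hx' =>
        hxO (h3 (tsupport_partialDeriv_subset ψ i hx'))
      simp [this]
  have e3 : ∫ x in Ω, P x * partialDeriv i ψ x = ∫ x, P x * partialDeriv i ψ x :=
    setIntegral_eq_integral_of_forall_compl_eq_zero fun x hx => by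
      rw [image_eq_zero_of_notMem_tsupport (f := partialDeriv i ψ)
        (fun hx' => hx ((hψ.partialDeriv i).supp hx')), mul_zero]
  have e4 : ∫ x in Ω, partialDeriv i P x * ψ x = ∫ x, partialDeriv i P x * ψ x :=
    setIntegral_eq_integral_of_forall_compl_eq_zero fun x hx => by
      rw [image_eq_zero_of_notMem_tsupport (f := ψ) (fun hx' => hx (hψ.supp hx')), mul_zero]
  have i2' : Integrable (fun x => partialDeriv i P x * ψ x) volume :=
    Continuous.integrable_of_hasCompactSupport (hcP.mul hψ.continuous) h2.mul_left
  have e5 : ∫ x, P x * partialDeriv i ψ x = -∫ x, partialDeriv i P x * ψ x :=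
    integral_mul_fderiv_eq_neg_fderiv_mul_of_integrable
      (f := P) (g := ψ) (v := EuclideanSpace.single i 1) i2'
      (Continuous.integrable_of_hasCompactSupport
        (hP.continuous.mul (hψ.partialDeriv i).continuous) (hψ.partialDeriv i).compact.mul_left)
      (Continuous.integrable_of_hasCompactSupport (hP.continuous.mul hψ.continuous) h2.mul_left)
      (fun x _ => hP.differentiable (by simp) x) (fun x _ => h1.differentiable (by simp) x)
  have i1 : Integrable (fun x => grad v x i * ψ x) (vol Ω) :=
    (memLp_grad v i).integrable_mul hψ.memLp
  have e6 : ∫ x, ψ x • (grad v x i - partialDeriv i P x)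
      = ∫ x in Ω, (grad v x i * ψ x - partialDeriv i P x * ψ x) := by
    rw [← setIntegral_eq_integral_of_forall_compl_eq_zero (s := Ω)]
    · exact integral_congr_ae (ae_of_all _ fun x => by simp only [smul_eq_mul]; ring)
    · intro x hx
      rw [image_eq_zero_of_notMem_tsupport (f := ψ) (fun hx' => hx (hψ.supp hx')), zero_smul]
  rw [e6, integral_sub i1 i2'.integrableOn]
  linarith

theorem grad_ae_eq_partialDeriv_of_test (hΩ : IsOpen Ω) [IsFiniteMeasure (vol Ω)] {v : H1 Ω}
    {φ : Rn n → ℝ} (hφ : IsTest Ω φ) (h : val v =ᵐ[vol Ω] φ) (i : Fin n) :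
    (fun x => grad v x i) =ᵐ[vol Ω] partialDeriv i φ := by
  filter_upwards [grad_ae_eq_partialDeriv hΩ hφ.smooth (K := Set.univ)
    (h.mono fun x hx _ => hx) i] with x hx
  exact hx (by simp)

theorem integral_mul_val_eq_inner (v w : H1 Ω) :
    ∫ x in Ω, val w x * val v x = inner ℝ w.1.fst v.1.fst := by
  rw [L2.inner_def]
  exact integral_congr_ae (ae_of_all _ fun x => mul_comm _ _)

/-- An element of `H¹₀` with zero gradient vanishes. Since `xᵢ φ` is a test function with `φ`,
the functional `v ↦ ∫ w v + ∫ w xᵢ ∂ᵢ v` vanishes on test functions when `Dw = 0`, hence on `H¹₀`;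
its value at `w` is `∫ w²`. -/
theorem eq_zero_of_mem_H10_of_grad (hΩ : IsOpen Ω) (hb : Bornology.IsBounded Ω) (i : Fin n)
    {w : H1 Ω} (hw : w ∈ H10 Ω) (h : grad w =ᵐ[vol Ω] 0) : w = 0 := by
  have : IsFiniteMeasure (vol Ω) := ⟨by simpa using hb.measure_lt_top⟩
  obtain ⟨R, hR⟩ := hb.exists_norm_le
  -- the field `w xᵢ eᵢ` as an element of `L²(Ω)ⁿ`
  have hp : MemLp (fun x => (val w x * x i) • (EuclideanSpace.single i 1 : Rn n)) 2 (vol Ω) := by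
    have h1 : MemLp (fun x : Rn n => val w x * x i) 2 (vol Ω) := by
      refine MemLp.of_le_mul (c := R) (memLp_val w) ?_ ?_
      · exact (memLp_val w).1.mul (by fun_prop : Continuous fun x : Rn n => x i).aestronglyMeasurable
      · filter_upwards [ae_restrict_mem hΩ.measurableSet] with x hx
        rw [norm_mul, mul_comm]
        exact mul_le_mul_of_nonneg_right ((PiLp.norm_apply_le x i).trans (hR x hx)) (norm_nonneg _)
    exact h1.continuousLinearMap_comp
      (ContinuousLinearMap.toSpanSingleton ℝ (EuclideanSpace.single i 1 : Rn n))
  set P : Lp (Rn n) 2 (vol Ω) := hp.toLp _ with hP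
  have hPx : ∀ v : H1 Ω, inner ℝ P v.1.snd = ∫ x in Ω, val w x * x i * grad v x i := by
    intro v
    rw [L2.inner_def]
    apply integral_congr_ae
    filter_upwards [hp.coeFn_toLp] with x hx
    rw [hx, inner_smul_left, EuclideanSpace.inner_single_left]
    simp [grad]
  have hclosed : IsClosed {v : H1 Ω | inner ℝ w.1.fst v.1.fst + inner ℝ P v.1.snd = (0 : ℝ)} := by
    have c1 : Continuous fun v : H1 Ω => v.1.fst :=
      (WithLp.fstL 2 ℝ _ _).continuous.comp continuous_subtype_val
    have c2 : Continuous fun v : H1 Ω => v.1.snd :=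
      (WithLp.sndL 2 ℝ _ _).continuous.comp continuous_subtype_val
    exact isClosed_eq ((continuous_const.inner c1).add (continuous_const.inner c2))
      continuous_const
  have hsub : (Submodule.span ℝ {v : H1 Ω | ∃ φ, IsTest Ω φ ∧ val v =ᵐ[vol Ω] φ} : Set (H1 Ω))
      ⊆ {v : H1 Ω | inner ℝ w.1.fst v.1.fst + inner ℝ P v.1.snd = (0 : ℝ)} := by
    intro v hv
    obtain ⟨φ, hφ, hvφ⟩ := exists_test_of_mem_span hv
    have hg := grad_ae_eq_partialDeriv_of_test hΩ hφ hvφ i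
    have hcoord : ContDiff ℝ ∞ (fun x : Rn n => x i) := by fun_prop
    have h1 := integral_val_mul_partialDeriv w (hφ.mul_smooth hcoord) i
    have h2 : ∫ x in Ω, grad w x i * ((fun x : Rn n => x i) * φ) x = 0 := by
      apply integral_eq_zero_of_ae
      filter_upwards [h] with x hx
      simp [hx]
    have h3 : ∀ x, partialDeriv i ((fun x : Rn n => x i) * φ) x
        = φ x + x i * partialDeriv i φ x := by
      intro x
      have e1 : HasFDerivAt (fun x : Rn n => x i) (EuclideanSpace.proj i : Rn n →L[ℝ] ℝ) x :=
        (EuclideanSpace.proj i : Rn n →L[ℝ] ℝ).hasFDerivAt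
      have e2 := e1.mul (hφ.smooth.differentiable (by simp) x).hasFDerivAt
      simp only [partialDeriv, e2.fderiv]
      simp
      ring
    have i1 : Integrable (fun x => val w x * val v x) (vol Ω) :=
      (memLp_val w).integrable_mul (memLp_val v)
    have i2 : Integrable (fun x => val w x * x i * grad v x i) (vol Ω) := by
      have := (MemLp.integrable_mul (hp.continuousLinearMap_comp
        (EuclideanSpace.proj i : Rn n →L[ℝ] ℝ)) (memLp_grad v i))
      refine this.congr (ae_of_all _ fun x => ?_)
      simp
    change inner ℝ w.1.fst v.1.fst + inner ℝ P v.1.snd = (0 : ℝ)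
    rw [hPx, ← integral_mul_val_eq_inner, ← integral_add i1 i2, ← neg_zero, ← h2, ← h1]
    apply integral_congr_ae
    filter_upwards [hvφ, hg] with x hx hx'
    rw [h3, hx, hx']
    ring
  have hmem := closure_minimal hsub hclosed hw
  have h0 : inner ℝ P w.1.snd = (0 : ℝ) := by
    rw [hPx]
    apply integral_eq_zero_of_ae
    filter_upwards [h] with x hx
    simp [hx]
  have h1 : inner ℝ w.1.fst w.1.fst = (0 : ℝ) := by
    have := hmem
    simp only [Set.mem_ofPred_eq] at this
    linarith
  have h2 : w.1.fst = 0 := inner_self_eq_zero.1 h1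
  exact eq_zero_of_val_grad ((Lp.eq_zero_iff_ae_eq_zero).1 h2) h

/-! ### Traces and the space `W₀` -/

theorem hasTrace_zero : HasTrace (0 : H1 Ω) 0 :=
  ⟨MemLp.zero, fun _ => 0, fun _ => 0, fun _ => contDiff_const, fun _ => val_zero,
    tendsto_const_nhds, by simp⟩

theorem HasTrace.add {v w : H1 Ω} {γ δ : Rn n → ℝ} (hv : HasTrace v γ) (hw : HasTrace w δ) :
    HasTrace (v + w) (γ + δ) := by
  obtain ⟨hγ, φ, V, h1, h2, h3, h4⟩ := hv
  obtain ⟨hδ, ψ, W, k1, k2, k3, k4⟩ := hw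
  refine ⟨hγ.add hδ, fun m => φ m + ψ m, fun m => V m + W m, fun m => (h1 m).add (k1 m),
    fun m => (val_add _ _).trans ((h2 m).add (k2 m)), h3.add k3, ?_⟩
  refine tendsto_of_tendsto_of_tendsto_of_le_of_le tendsto_const_nhds
    (by simpa using h4.add k4) (fun _ => zero_le) fun m => ?_
  have e : φ m + ψ m - (γ + δ) = (φ m - γ) + (ψ m - δ) := by abel
  rw [e]
  exact eLpNorm_add_le ((h1 m).continuous.aestronglyMeasurable.sub hγ.1)
    ((k1 m).continuous.aestronglyMeasurable.sub hδ.1) (by norm_num)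

theorem HasTrace.smul {v : H1 Ω} {γ : Rn n → ℝ} (hv : HasTrace v γ) (c : ℝ) :
    HasTrace (c • v) (c • γ) := by
  obtain ⟨hγ, φ, V, h1, h2, h3, h4⟩ := hv
  refine ⟨hγ.const_smul c, fun m => c • φ m, fun m => c • V m,
    fun m => contDiff_const.smul (h1 m),
    fun m => (val_smul _ _).trans ((h2 m).const_smul c), h3.const_smul c, ?_⟩
  have e : ∀ m, eLpNorm (c • φ m - c • γ) 2 (surf Ω)
      = ‖c‖ₑ * eLpNorm (φ m - γ) 2 (surf Ω) := fun m => by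
    rw [← smul_sub, eLpNorm_const_smul]
  simp_rw [e]
  simpa using ENNReal.Tendsto.const_mul h4 (Or.inr (by simp))

/-- Elements of `H¹₀` have trace zero. -/
theorem hasTrace_zero_of_mem_H10 (hΩ : IsOpen Ω) {v : H1 Ω} (hv : v ∈ H10 Ω) :
    HasTrace v 0 := by
  have hv' : v ∈ closure (Submodule.span ℝ
      {v : H1 Ω | ∃ φ, IsTest Ω φ ∧ val v =ᵐ[vol Ω] φ} : Set (H1 Ω)) := hv
  obtain ⟨V, hV, hlim⟩ := mem_closure_iff_seq_limit.1 hv'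
  choose φ hφ hVφ using fun m => exists_test_of_mem_span (hV m)
  refine ⟨MemLp.zero, φ, V, fun m => (hφ m).smooth, hVφ, hlim, ?_⟩
  have e : ∀ m, eLpNorm (φ m - 0) 2 (surf Ω) = 0 := fun m => by
    rw [sub_zero, ← eLpNorm_zero (μ := surf Ω) (p := 2) (ε := ℝ)]
    apply eLpNorm_congr_ae
    filter_upwards [ae_restrict_mem isClosed_frontier.measurableSet] with x hx
    refine image_eq_zero_of_notMem_tsupport fun hx' => ?_
    exact (hΩ.frontier_eq ▸ hx).2 ((hφ m).supp hx')
  simp_rw [e]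
  exact tendsto_const_nhds

/-- `W₀` as a linear subspace of the matrix fields. Traces add up along sums of the approximating
sequences, so linearity needs no uniqueness of traces. -/
def WZero (Ω : Set (Rn n)) : Submodule ℝ (Matrix (Fin n) (Fin n) (H1 Ω)) where
  carrier := W Ω 0
  zero_mem' := ⟨Matrix.isSymm_zero, fun _ _ => 0, fun _ _ => hasTrace_zero,
    ae_of_all _ fun x ν _ => by simp⟩
  add_mem' := by
    rintro μ μ' ⟨h1, γ, h2, h3⟩ ⟨k1, δ, k2, k3⟩
    refine ⟨h1.add k1, fun i j => γ i j + δ i j, fun i j => (h2 i j).add (k2 i j), ?_⟩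
    filter_upwards [h3, k3] with x hx kx ν hν
    have := congrArg₂ (· + ·) (hx ν hν) (kx ν hν)
    simpa [add_mul, Finset.sum_add_distrib] using this
  smul_mem' := by
    rintro c μ ⟨h1, γ, h2, h3⟩
    refine ⟨h1.smul c, fun i j => c • γ i j, fun i j => (h2 i j).smul c, ?_⟩
    filter_upwards [h3] with x hx ν hν
    have := congrArg (c * ·) (hx ν hν)
    simpa [Finset.mul_sum, mul_assoc] using this

/-- The isotropic field `v I` belongs to `W₀` when `v ∈ H¹₀`. -/
theorem scalar_mem_W (hΩ : IsOpen Ω) {v : H1 Ω} (hv : v ∈ H10 Ω) :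
    Matrix.diagonal (fun _ => v) ∈ W Ω 0 := by
  refine ⟨Matrix.isSymm_diagonal _, fun _ _ => 0, fun i j => ?_,
    ae_of_all _ fun x ν _ => by simp⟩
  by_cases hij : i = j
  · subst hij
    simpa using hasTrace_zero_of_mem_H10 hΩ hv
  · rw [Matrix.diagonal_apply_ne _ hij]
    exact hasTrace_zero

/-! ### The finite element space -/

theorem IsCell.convex {kind : MeshKind} {K : Set (Rn n)} (h : IsCell kind K) : Convex ℝ K := by
  cases kind with
  | simplicial =>
    obtain ⟨s, rfl⟩ := h
    exact convex_convexHull ℝ _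
  | rectangular =>
    obtain ⟨a, b, -, rfl⟩ := h
    intro x hx y hy s t hs ht hst i
    have h1 := hx i
    have h2 := hy i
    have e : (s • x + t • y) i = s * x i + t * y i := by simp
    have ea : a i = s * a i + t * a i := by rw [← add_mul, hst, one_mul]
    have eb : b i = s * b i + t * b i := by rw [← add_mul, hst, one_mul]
    rw [e]
    constructor
    · rw [ea]
      exact add_le_add (mul_le_mul_of_nonneg_left h1.1 hs) (mul_le_mul_of_nonneg_left h2.1 ht)
    · rw [eb]
      exact add_le_add (mul_le_mul_of_nonneg_left h1.2 hs) (mul_le_mul_of_nonneg_left h2.2 ht)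

/-- The finite element space as a linear subspace of `H¹`. -/
def VhSpace (kind : MeshKind) (Ω : Set (Rn n)) (T : Finset (Set (Rn n))) (k : ℕ) :
    Submodule ℝ (H1 Ω) where
  carrier := Vh kind Ω T k
  zero_mem' := ⟨0, val_zero, continuousOn_const, fun _ _ => ⟨0, zero_mem _, fun x _ => by simp⟩⟩
  add_mem' := by
    rintro v w ⟨v', h1, h2, h3⟩ ⟨w', k1, k2, k3⟩
    refine ⟨v' + w', (val_add v w).trans (h1.add k1), h2.add k2, fun K hK => ?_⟩
    obtain ⟨p, hp, hp'⟩ := h3 K hK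
    obtain ⟨q, hq, hq'⟩ := k3 K hK
    exact ⟨p + q, add_mem hp hq, fun x hx => by simp [hp' x hx, hq' x hx]⟩
  smul_mem' := by
    rintro c v ⟨v', h1, h2, h3⟩
    refine ⟨c • v', (val_smul c v).trans (h1.const_smul c), h2.const_smul c, fun K hK => ?_⟩
    obtain ⟨p, hp, hp'⟩ := h3 K hK
    exact ⟨c • p, Submodule.smul_mem _ c hp, fun x hx => by
      simp [hp' x hx, MvPolynomial.smul_eval]⟩

theorem contDiff_eval (p : MvPolynomial (Fin n) ℝ) :
    ContDiff ℝ ∞ (fun x : Rn n => MvPolynomial.eval (fun i => x i) p) := by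
  induction p using MvPolynomial.induction_on with
  | C a => simpa using contDiff_const
  | add p q hp hq => simpa using hp.add hq
  | mul_X p i hp =>
    simp only [map_mul, MvPolynomial.eval_X]
    exact hp.mul (by fun_prop)

instance finite_localPoly (n k : ℕ) (kind : MeshKind) :
    Module.Finite ℝ (localPoly n k kind) := by
  cases kind
  · exact inferInstanceAs (Module.Finite ℝ (MvPolynomial.restrictTotalDegree (Fin n) ℝ k))
  · exact inferInstanceAs (Module.Finite ℝ (MvPolynomial.restrictDegree (Fin n) ℝ k))

/-- The function which at `x` takes the value of the polynomial attached to the cell `c x`. -/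
noncomputable def piecewisePoly {kind : MeshKind} {T : Finset (Set (Rn n))} {k : ℕ} (c : Rn n → T) :
    (T → localPoly n k kind) →ₗ[ℝ] (Rn n → ℝ) where
  toFun p x := MvPolynomial.eval (fun i => x i) (p (c x)).1
  map_add' p q := by ext x; simp
  map_smul' a p := by ext x; simp [MvPolynomial.smul_eval]

/-- The finite element space is finite dimensional: an element of `H¹` is determined by its values,
and those of a finite element function by the finitely many local polynomials. -/
theorem finite_VhSpace (hΩ : IsOpen Ω) [IsFiniteMeasure (vol Ω)] (hne : Ω.Nonempty)
    {kind : MeshKind} {T : Finset (Set (Rn n))} (hT : IsMesh kind Ω T) (k : ℕ) :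
    Module.Finite ℝ (VhSpace kind Ω T k) := by
  have hcov : ∀ x ∈ Ω, ∃ K : T, x ∈ K.1 := fun x hx => by
    have : x ∈ ⋃ K ∈ T, K := hT.cover ▸ subset_closure hx
    simp only [Set.mem_iUnion] at this
    obtain ⟨K, hK, hxK⟩ := this
    exact ⟨⟨K, hK⟩, hxK⟩
  obtain ⟨x₀, hx₀⟩ := hne
  obtain ⟨K₀, -⟩ := hcov x₀ hx₀
  have hex : ∃ c : Rn n → T, ∀ x ∈ Ω, x ∈ (c x).1 := by
    classical
    exact ⟨fun x => if hx : x ∈ Ω then (hcov x hx).choose else K₀, fun x hx => by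
      simpa [hx] using (hcov x hx).choose_spec⟩
  obtain ⟨c, hc⟩ := hex
  -- the graph relation between families of local polynomials and the elements of `H¹` they represent
  let G : Submodule ℝ ((T → localPoly n k kind) × H1 Ω) :=
    { carrier := {z | val z.2 =ᵐ[vol Ω] piecewisePoly c z.1}
      zero_mem' := by
        change val (0 : H1 Ω) =ᵐ[vol Ω] piecewisePoly c 0
        rw [map_zero]
        exact val_zero
      add_mem' := by
        intro z z' hz hz'
        change val (z.2 + z'.2) =ᵐ[vol Ω] piecewisePoly c (z.1 + z'.1)
        rw [map_add]
        exact (val_add _ _).trans (EventuallyEq.add hz hz')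
      smul_mem' := by
        intro a z hz
        change val (a • z.2) =ᵐ[vol Ω] piecewisePoly c (a • z.1)
        rw [map_smul]
        have hz' : val z.2 =ᵐ[vol Ω] piecewisePoly c z.1 := hz
        exact (val_smul _ _).trans (hz'.const_smul a) }
  have hinj : Function.Injective ((LinearMap.fst ℝ (T → localPoly n k kind) (H1 Ω)).comp
      G.subtype) := by
    refine (injective_iff_map_eq_zero _).2 ?_
    rintro ⟨⟨p, v⟩, hz⟩ h0
    have hp : p = 0 := h0
    subst hp
    have hz' : val v =ᵐ[vol Ω] piecewisePoly c 0 := hz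
    rw [map_zero] at hz'
    have hv := eq_zero_of_val hΩ hz'
    subst hv
    rfl
  have hG : Module.Finite ℝ G := Module.Finite.of_injective _ hinj
  have hG' : Module.Finite ℝ (G.map (LinearMap.snd ℝ (T → localPoly n k kind) (H1 Ω))) :=
    Module.Finite.map _ _
  refine Submodule.finiteDimensional_of_le
    (S₂ := G.map (LinearMap.snd ℝ (T → localPoly n k kind) (H1 Ω))) ?_
  rintro v ⟨v', h1, -, h3⟩
  choose p hp hp' using h3
  refine ⟨(fun K => ⟨p K.1 K.2, hp K.1 K.2⟩, v), ?_, rfl⟩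
  change val v =ᵐ[vol Ω] piecewisePoly c _
  filter_upwards [h1, ae_restrict_mem hΩ.measurableSet] with x hx hxΩ
  rw [hx]
  exact hp' _ _ x (hc x hxΩ)

/-- Finite element functions have bounded gradients. -/
theorem exists_bound_grad (hΩ : IsOpen Ω) (hb : Bornology.IsBounded Ω)
    {kind : MeshKind} {T : Finset (Set (Rn n))} (hT : IsMesh kind Ω T) {k : ℕ} {v : H1 Ω}
    (hv : v ∈ Vh kind Ω T k) : ∃ C : ℝ, ∀ᵐ x ∂(vol Ω), ∀ i, ‖grad v x i‖ ≤ C := by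
  have : IsFiniteMeasure (vol Ω) := ⟨by simpa using hb.measure_lt_top⟩
  obtain ⟨v', h1, -, h3⟩ := hv
  have hcell : ∀ K : T, ∃ C : ℝ, ∀ᵐ x ∂(vol Ω), x ∈ interior K.1 → ∀ i, ‖grad v x i‖ ≤ C := by
    rintro ⟨K, hK⟩
    obtain ⟨p, -, hp⟩ := h3 K hK
    have hP := contDiff_eval p
    have hbd : ∀ i : Fin n, ∃ C : ℝ, ∀ x ∈ closure Ω,
        ‖partialDeriv i (fun x : Rn n => MvPolynomial.eval (fun i => x i) p) x‖ ≤ C := fun i =>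
      hb.isCompact_closure.exists_bound_of_continuousOn
        (contDiff_partialDeriv hP i).continuous.continuousOn
    choose C hC using hbd
    refine ⟨∑ i, |C i|, ?_⟩
    have hg := fun i => grad_ae_eq_partialDeriv hΩ (v := v) hP (K := K) (by
      filter_upwards [h1] with x hx hxK
      rw [hx, hp x hxK]) i
    filter_upwards [ae_all_iff.2 hg, ae_restrict_mem hΩ.measurableSet] with x hx hxΩ hxK i
    rw [hx i hxK]
    exact (hC i x (subset_closure hxΩ)).trans ((le_abs_self _).trans
      (Finset.single_le_sum (f := fun i => |C i|) (fun _ _ => abs_nonneg _) (Finset.mem_univ i)))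
  choose C hC using hcell
  refine ⟨∑ K, |C K|, ?_⟩
  have hfr : ∀ K : T, ∀ᵐ x ∂(vol Ω), x ∉ frontier K.1 := fun K =>
    ae_restrict_of_ae (measure_eq_zero_iff_ae_notMem.1
      ((hT.cell K.1 K.2).convex.addHaar_frontier volume))
  filter_upwards [ae_all_iff.2 hC, ae_all_iff.2 hfr, ae_restrict_mem hΩ.measurableSet]
    with x hx hx' hxΩ i
  have hmem : x ∈ ⋃ K ∈ T, K := hT.cover ▸ subset_closure hxΩ
  simp only [Set.mem_iUnion] at hmem
  obtain ⟨K, hK, hxK⟩ := hmem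
  have hint : x ∈ interior K := by
    by_contra hn
    exact hx' ⟨K, hK⟩ ⟨subset_closure hxK, hn⟩
  exact (hx ⟨K, hK⟩ hint i).trans ((le_abs_self _).trans
    (Finset.single_le_sum (f := fun K => |C K|) (fun _ _ => abs_nonneg _) (Finset.mem_univ _)))

/-! ### Positivity of the cofactor matrix of the Hessian -/

/-- An integrable function on an open set which is nonnegative as a distribution is nonnegative
almost everywhere: it is the almost everywhere limit of its mollifications. -/
theorem ae_nonneg_of_forall_test (hΩ : IsOpen Ω) {h : Rn n → ℝ} (hh : Integrable h (vol Ω))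
    (H : ∀ φ, IsTest Ω φ → (∀ x, 0 ≤ φ x) → 0 ≤ ∫ x in Ω, h x * φ x) :
    ∀ᵐ x ∂(vol Ω), 0 ≤ h x := by
  let b : ℕ → ContDiffBump (0 : Rn n) := fun m =>
    { rIn := 1 / ((m : ℝ) + 1)
      rOut := 2 * (1 / ((m : ℝ) + 1))
      rIn_pos := by positivity
      rIn_lt_rOut := by
        have : 0 < 1 / ((m : ℝ) + 1) := by positivity
        linarith }
  have hlim : Tendsto (fun m => (b m).rOut) atTop (𝓝 0) := by
    have := (tendsto_one_div_add_atTop_nhds_zero_nat (𝕜 := ℝ)).const_mul 2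
    simpa [b] using this
  have key := ContDiffBump.ae_convolution_tendsto_right_of_locallyIntegrable (K := 2) hlim
    (Eventually.of_forall fun m => le_refl _)
    ((integrable_indicator_iff hΩ.measurableSet).2 hh).locallyIntegrable
  filter_upwards [ae_restrict_of_ae key, ae_restrict_mem hΩ.measurableSet] with x hx hxΩ
  rw [Set.indicator_of_mem hxΩ] at hx
  refine ge_of_tendsto hx ?_
  obtain ⟨δ, hδ, hball⟩ := Metric.isOpen_iff.1 hΩ x hxΩ
  filter_upwards [hlim.eventually (gt_mem_nhds hδ)] with m hm
  set ψ : Rn n → ℝ := fun t => (b m).normed volume (x - t) with hψ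
  have hsupp : tsupport ψ ⊆ Metric.closedBall x (b m).rOut := by
    refine closure_minimal (fun t ht => ?_) Metric.isClosed_closedBall
    have h1 : x - t ∈ Function.support ((b m).normed volume) := ht
    rw [ContDiffBump.support_normed_eq, mem_ball_zero_iff] at h1
    rw [Metric.mem_closedBall, dist_comm, dist_eq_norm]
    exact h1.le
  have hψt : IsTest Ω ψ :=
    { smooth := (ContDiffBump.contDiff_normed (b m)).comp (contDiff_const.sub contDiff_id)
      compact := (isCompact_closedBall x (b m).rOut).of_isClosed_subset (isClosed_tsupport _) hsupp
      supp := hsupp.trans ((Metric.closedBall_subset_ball hm).trans hball) }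
  have h2 := H ψ hψt fun t => ContDiffBump.nonneg_normed (b m) _
  rw [convolution_eq_swap]
  refine h2.trans_eq ?_
  rw [← integral_indicator hΩ.measurableSet]
  refine integral_congr_ae (ae_of_all _ fun t => ?_)
  by_cases ht : t ∈ Ω
  · simp [ht, hψ, mul_comm]
  · simp [ht]

theorem hasDerivAt_integral_mul_translate {U φ : Rn n → ℝ} (hU : Integrable U (vol Ω))
    (hφ : ContDiff ℝ ∞ φ) (hc : HasCompactSupport φ) (ξ : Rn n) (s : ℝ) :
    HasDerivAt (fun s : ℝ => ∫ x in Ω, U x * φ (x + s • ξ))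
      (∫ x in Ω, U x * fderiv ℝ φ (x + s • ξ) ξ) s := by
  have hd : Continuous fun x => fderiv ℝ φ x ξ :=
    (hφ.continuous_fderiv (by simp)).clm_apply continuous_const
  obtain ⟨C, hC⟩ := HasCompactSupport.exists_bound_of_continuous
    ((hc.fderiv (𝕜 := ℝ)).comp_left (g := fun L : Rn n →L[ℝ] ℝ => L ξ) (by simp)) hd
  obtain ⟨C', hC'⟩ := hc.exists_bound_of_continuous hφ.continuous
  refine (hasDerivAt_integral_of_dominated_loc_of_deriv_le (s := Set.univ)
    (F := fun (s : ℝ) (x : Rn n) => U x * φ (x + s • ξ))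
    (F' := fun (s : ℝ) (x : Rn n) => U x * fderiv ℝ φ (x + s • ξ) ξ)
    (bound := fun x => ‖U x‖ * C) univ_mem ?_ ?_ ?_ ?_ ?_ ?_).2
  · exact Eventually.of_forall fun s => hU.1.mul
      (hφ.continuous.comp (by fun_prop : Continuous fun x : Rn n => x + s • ξ)).aestronglyMeasurable
  · exact hU.mul_bdd (c := C')
      (hφ.continuous.comp (by fun_prop : Continuous fun x : Rn n => x + s • ξ)).aestronglyMeasurable
      (ae_of_all _ fun x => hC' _)
  · exact hU.1.mul
      (hd.comp (by fun_prop : Continuous fun x : Rn n => x + s • ξ)).aestronglyMeasurable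
  · exact ae_of_all _ fun x s _ => by
      rw [norm_mul]
      exact mul_le_mul_of_nonneg_left (hC _) (norm_nonneg _)
  · exact hU.norm.mul_const C
  · refine ae_of_all _ fun x s _ => ?_
    have h1 : HasDerivAt (fun s : ℝ => x + s • ξ) ξ s := by
      simpa using ((hasDerivAt_id s).smul_const ξ).const_add x
    have h2 := (hφ.differentiable (by simp) (x + s • ξ)).hasFDerivAt.comp_hasDerivAt s h1
    exact h2.const_mul (U x)

/-- A symmetric second difference of a convex function, tested with `φ ≥ 0`, is nonnegative. -/
theorem two_mul_integral_le_integral_translate (hΩ : IsOpen Ω) {U φ : Rn n → ℝ}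
    (hU : Integrable U (vol Ω)) (hconv : ConvexOn ℝ Ω U) (hφ : IsTest Ω φ) (h0 : ∀ x, 0 ≤ φ x)
    {η : Rn n} (hη : ∀ x ∈ tsupport φ, x + η ∈ Ω ∧ x - η ∈ Ω) :
    2 * ∫ x in Ω, U x * φ x ≤ (∫ x in Ω, U x * φ (x + η)) + ∫ x in Ω, U x * φ (x - η) := by
  set V : Rn n → ℝ := Ω.indicator U with hV
  have hVi : Integrable V volume := (integrable_indicator_iff hΩ.measurableSet).2 hU
  obtain ⟨C, hC⟩ := hφ.compact.exists_bound_of_continuous hφ.continuous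
  have e : ∀ ψ : Rn n → ℝ, ∫ x in Ω, U x * ψ x = ∫ x, V x * ψ x := fun ψ => by
    rw [← integral_indicator hΩ.measurableSet]
    refine integral_congr_ae (ae_of_all _ fun x => ?_)
    by_cases hx : x ∈ Ω <;> simp [hV, hx]
  have e1 : ∫ x, V x * φ (x + η) = ∫ x, V (x - η) * φ x := by
    rw [← integral_sub_right_eq_self (fun x => V x * φ (x + η)) η]
    simp
  have e2 : ∫ x, V x * φ (x - η) = ∫ x, V (x + η) * φ x := by
    rw [← integral_add_right_eq_self (fun x => V x * φ (x - η)) η]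
    simp
  have i0 : Integrable (fun x => V x * φ x) volume :=
    hVi.mul_bdd (c := C) hφ.continuous.aestronglyMeasurable (ae_of_all _ hC)
  have i1 : Integrable (fun x => V (x - η) * φ x) volume :=
    (hVi.comp_sub_right η).mul_bdd (c := C) hφ.continuous.aestronglyMeasurable (ae_of_all _ hC)
  have i2 : Integrable (fun x => V (x + η) * φ x) volume :=
    (hVi.comp_add_right η).mul_bdd (c := C) hφ.continuous.aestronglyMeasurable (ae_of_all _ hC)
  rw [e, e (fun x => φ (x + η)), e (fun x => φ (x - η)), e1, e2, ← integral_add i1 i2,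
    ← integral_const_mul]
  refine integral_mono (i0.const_mul 2) (i1.add i2) fun x => ?_
  by_cases hx : x ∈ tsupport φ
  · obtain ⟨hp, hm⟩ := hη x hx
    have h1 := hconv.2 hm hp (by norm_num : (0 : ℝ) ≤ 1 / 2) (by norm_num : (0 : ℝ) ≤ 1 / 2) (by norm_num)
    have h2 : (1 / 2 : ℝ) • (x - η) + (1 / 2 : ℝ) • (x + η) = x := by module
    rw [h2] at h1
    simp only [hV, Set.indicator_of_mem hp, Set.indicator_of_mem hm,
      Set.indicator_of_mem (hφ.supp hx)]
    simp only [smul_eq_mul] at h1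
    nlinarith [mul_le_mul_of_nonneg_right h1 (h0 x)]
  · simp [image_eq_zero_of_notMem_tsupport hx]

/-- The second directional derivatives of a convex function are nonnegative distributions. The
function `s ↦ ∫ U (φ(x + s ξ) + φ(x - s ξ))` is minimal at `0`, so its second derivative there is
nonnegative. -/
theorem integral_mul_fderiv_fderiv_nonneg (hΩ : IsOpen Ω) {U φ : Rn n → ℝ}
    (hU : Integrable U (vol Ω)) (hconv : ConvexOn ℝ Ω U) (hφ : IsTest Ω φ) (h0 : ∀ x, 0 ≤ φ x)
    (ξ : Rn n) :
    0 ≤ ∫ x in Ω, U x * fderiv ℝ (fun y => fderiv ℝ φ y ξ) x ξ := by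
  set φ₁ : Rn n → ℝ := fun y => fderiv ℝ φ y ξ with hφ₁
  have hs₁ : ContDiff ℝ ∞ φ₁ := (hφ.smooth.fderiv_right (m := ∞) (by simp)).clm_apply contDiff_const
  have hc₁ : HasCompactSupport φ₁ :=
    (hφ.compact.fderiv (𝕜 := ℝ)).comp_left (g := fun L : Rn n →L[ℝ] ℝ => L ξ) (by simp)
  set G : ℝ → ℝ := fun s => ∫ x in Ω, U x * φ (x + s • ξ) with hG
  set G₁ : ℝ → ℝ := fun s => ∫ x in Ω, U x * φ₁ (x + s • ξ) with hG₁
  have d0 : ∀ s, HasDerivAt G (G₁ s) s := fun s =>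
    hasDerivAt_integral_mul_translate hU hφ.smooth hφ.compact ξ s
  have d1 : HasDerivAt G₁ (∫ x in Ω, U x * fderiv ℝ φ₁ x ξ) 0 := by
    simpa using hasDerivAt_integral_mul_translate hU hs₁ hc₁ ξ 0
  set H : ℝ → ℝ := fun s => G s + G (-s) with hH
  have dH : deriv H = fun s => G₁ s - G₁ (-s) := by
    funext s
    have := (d0 s).add ((d0 (-s)).comp s (hasDerivAt_neg s))
    simp only [mul_neg, mul_one, ← sub_eq_add_neg] at this
    exact this.deriv
  have dHH : deriv (deriv H) 0 = 2 * ∫ x in Ω, U x * fderiv ℝ φ₁ x ξ := by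
    rw [dH]
    have d1' : HasDerivAt G₁ (∫ x in Ω, U x * fderiv ℝ φ₁ x ξ) (-(0 : ℝ)) := by simpa using d1
    have := d1.sub (d1'.comp 0 (hasDerivAt_neg 0))
    have e := this.deriv
    simp only [Function.comp_def, mul_neg, mul_one, sub_neg_eq_add] at e
    rw [two_mul, ← e]
    rfl
  have hmin : IsLocalMin H 0 := by
    obtain ⟨δ, hδ, hsub⟩ := hφ.compact.isCompact.exists_thickening_subset_open hΩ hφ.supp
    have hev : ∀ᶠ s : ℝ in 𝓝 0, ‖s • ξ‖ < δ := by
      have hcont : Continuous fun s : ℝ => ‖s • ξ‖ := by fun_prop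
      exact hcont.continuousAt.eventually (gt_mem_nhds (by simpa using hδ))
    filter_upwards [hev] with s hs
    have := two_mul_integral_le_integral_translate hΩ hU hconv hφ h0 (η := s • ξ) fun x hx =>
      ⟨hsub (Metric.mem_thickening_iff.2 ⟨x, hx, by simpa [dist_eq_norm] using hs⟩),
        hsub (Metric.mem_thickening_iff.2 ⟨x, hx, by simpa [dist_eq_norm] using hs⟩)⟩
    have e0 : H 0 = 2 * ∫ x in Ω, U x * φ x := by simp [hH, hG, two_mul]
    have es : H s = (∫ x in Ω, U x * φ (x + s • ξ)) + ∫ x in Ω, U x * φ (x - s • ξ) := by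
      simp [hH, hG, sub_eq_add_neg]
    rw [e0, es]
    exact this
  by_contra hneg
  have hneg' : deriv (deriv H) 0 < 0 := by
    rw [dHH]
    linarith [not_le.1 hneg]
  have hcont : ContinuousAt H 0 := by
    have c1 : Continuous G := continuous_iff_continuousAt.2 fun s => (d0 s).continuousAt
    exact (c1.add (c1.comp continuous_neg)).continuousAt
  have hmax := isLocalMax_of_deriv_deriv_neg hneg' (by simp [dH]) hcont
  have hconst : H =ᶠ[𝓝 0] fun _ => H 0 := by
    filter_upwards [hmin, hmax] with s h1 h2
    exact le_antisymm h2 h1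
  have h3 : deriv H =ᶠ[𝓝 0] fun _ => 0 := by
    filter_upwards [hconst.deriv] with s hs
    simpa using hs
  have h4 : deriv (deriv H) 0 = 0 := by simpa using h3.deriv_eq
  linarith

theorem fderiv_apply_eq_sum_partialDeriv (φ : Rn n → ℝ) (x ξ : Rn n) :
    fderiv ℝ φ x ξ = ∑ i, ξ i * partialDeriv i φ x := by
  have h : ξ = ∑ i, ξ i • (EuclideanSpace.single i 1 : Rn n) := by
    simpa using ((EuclideanSpace.basisFun (Fin n) ℝ).sum_repr ξ).symm
  conv_lhs => rw [h]
  simp [partialDeriv]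

theorem fderiv_fderiv_apply_eq_sum {φ : Rn n → ℝ} (hφ : ContDiff ℝ ∞ φ) (x ξ : Rn n) :
    fderiv ℝ (fun y => fderiv ℝ φ y ξ) x ξ
      = ∑ i, ∑ j, ξ i * ξ j * partialDeriv i (partialDeriv j φ) x := by
  rw [fderiv_apply_eq_sum_partialDeriv]
  refine Finset.sum_congr rfl fun i _ => ?_
  have h1 : (fun y => fderiv ℝ φ y ξ) = fun y => ∑ j, ξ j * partialDeriv j φ y :=
    funext fun y => fderiv_apply_eq_sum_partialDeriv φ y ξ
  have h2 : partialDeriv i (fun y => ∑ j, ξ j * partialDeriv j φ y) x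
      = ∑ j, ξ j * partialDeriv i (partialDeriv j φ) x := by
    have h3 : HasFDerivAt (fun y => ∑ j, ξ j * partialDeriv j φ y)
        (∑ j, ξ j • fderiv ℝ (partialDeriv j φ) x) x :=
      HasFDerivAt.fun_sum fun j _ =>
        ((contDiff_partialDeriv hφ j).differentiable (by simp) x).hasFDerivAt.const_mul (ξ j)
    unfold partialDeriv at h3 ⊢
    rw [h3.fderiv]
    simp
  rw [h1, h2, Finset.mul_sum]
  exact Finset.sum_congr rfl fun j _ => by ring

/-- The weak Hessian of a convex function is positive semidefinite almost everywhere. -/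
theorem hessian_nonneg (hΩ : IsOpen Ω) [IsFiniteMeasure (vol Ω)] {u : H1 Ω}
    {σ : Matrix (Fin n) (Fin n) (H1 Ω)} (hσ : IsWeakHessian u σ) {u' : Rn n → ℝ}
    (hu : val u =ᵐ[vol Ω] u') (hconv : ConvexOn ℝ Ω u') :
    ∀ᵐ x ∂(vol Ω), ∀ ξ : Rn n, 0 ≤ ∑ i, ∑ j, ξ i * ξ j * val (σ i j) x := by
  have hU : Integrable u' (vol Ω) := ((memLp_val u).integrable (by norm_num)).congr hu
  have hone : ∀ ξ : Rn n, ∀ᵐ x ∂(vol Ω), 0 ≤ ∑ i, ∑ j, ξ i * ξ j * val (σ i j) x := by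
    intro ξ
    have hi : ∀ i j, Integrable (fun x => ξ i * ξ j * val (σ i j) x) (vol Ω) := fun i j =>
      ((memLp_val (σ i j)).integrable (by norm_num)).const_mul _
    refine ae_nonneg_of_forall_test hΩ
      (integrable_finsetSum _ fun i _ => integrable_finsetSum _ fun j _ => hi i j) ?_
    intro φ hφ h0
    have key := integral_mul_fderiv_fderiv_nonneg hΩ hU hconv hφ h0 ξ
    refine key.trans_eq ?_
    have e1 : ∀ i j, ∫ x in Ω, u' x * partialDeriv i (partialDeriv j φ) x
        = ∫ x in Ω, val (σ i j) x * φ x := by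
      intro i j
      have h1 := hσ φ hφ i j
      have h2 := integral_val_mul_partialDeriv u (hφ.partialDeriv j) i
      rw [h1, neg_neg] at h2
      rw [← h2]
      apply integral_congr_ae
      filter_upwards [hu] with x hx
      rw [hx]
    have i1 : ∀ i j, Integrable
        (fun x => ξ i * ξ j * (u' x * partialDeriv i (partialDeriv j φ) x)) (vol Ω) := by
      intro i j
      refine Integrable.const_mul ?_ _
      have : Integrable (fun x => val u x * partialDeriv i (partialDeriv j φ) x) (vol Ω) :=
        (memLp_val u).integrable_mul ((hφ.partialDeriv j).memLp_partialDeriv i)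
      refine this.congr ?_
      filter_upwards [hu] with x hx
      rw [hx]
    have i2 : ∀ i j, Integrable (fun x => ξ i * ξ j * (val (σ i j) x * φ x)) (vol Ω) :=
      fun i j => Integrable.const_mul ((memLp_val (σ i j)).integrable_mul hφ.memLp) _
    have l : ∫ x in Ω, u' x * fderiv ℝ (fun y => fderiv ℝ φ y ξ) x ξ
        = ∑ i, ∑ j, ξ i * ξ j * ∫ x in Ω, u' x * partialDeriv i (partialDeriv j φ) x := by
      have : ∀ x, u' x * fderiv ℝ (fun y => fderiv ℝ φ y ξ) x ξ
          = ∑ i, ∑ j, ξ i * ξ j * (u' x * partialDeriv i (partialDeriv j φ) x) := fun x => by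
        rw [fderiv_fderiv_apply_eq_sum hφ.smooth, Finset.mul_sum]
        refine Finset.sum_congr rfl fun i _ => ?_
        rw [Finset.mul_sum]
        exact Finset.sum_congr rfl fun j _ => by ring
      simp_rw [this]
      rw [integral_finsetSum _ fun i _ => integrable_finsetSum _ fun j _ => i1 i j]
      refine Finset.sum_congr rfl fun i _ => ?_
      rw [integral_finsetSum _ fun j _ => i1 i j]
      exact Finset.sum_congr rfl fun j _ => integral_const_mul _ _
    have r : ∫ x in Ω, (∑ i, ∑ j, ξ i * ξ j * val (σ i j) x) * φ x
        = ∑ i, ∑ j, ξ i * ξ j * ∫ x in Ω, val (σ i j) x * φ x := by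
      have : ∀ x, (∑ i, ∑ j, ξ i * ξ j * val (σ i j) x) * φ x
          = ∑ i, ∑ j, ξ i * ξ j * (val (σ i j) x * φ x) := fun x => by
        rw [Finset.sum_mul]
        refine Finset.sum_congr rfl fun i _ => ?_
        rw [Finset.sum_mul]
        exact Finset.sum_congr rfl fun j _ => by ring
      simp_rw [this]
      rw [integral_finsetSum _ fun i _ => integrable_finsetSum _ fun j _ => i2 i j]
      refine Finset.sum_congr rfl fun i _ => ?_
      rw [integral_finsetSum _ fun j _ => i2 i j]
      exact Finset.sum_congr rfl fun j _ => integral_const_mul _ _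
    rw [l, r]
    simp_rw [e1]
  -- the exceptional null set is made independent of `ξ` by letting `ξ` run through a dense sequence
  filter_upwards [ae_all_iff.2 fun m => hone (TopologicalSpace.denseSeq (Rn n) m)] with x hx ξ
  have hcl : IsClosed {ξ : Rn n | 0 ≤ ∑ i, ∑ j, ξ i * ξ j * val (σ i j) x} :=
    isClosed_le continuous_const (by fun_prop)
  have hsub : closure (Set.range (TopologicalSpace.denseSeq (Rn n)))
      ⊆ {ξ : Rn n | 0 ≤ ∑ i, ∑ j, ξ i * ξ j * val (σ i j) x} :=
    closure_minimal (Set.range_subset_iff.2 hx) hcl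
  exact hsub ((TopologicalSpace.denseRange_denseSeq (Rn n)) ξ)

/-- The adjugate of a positive semidefinite matrix is positive semidefinite: for `A + s I` with
`s > 0` it is a positive multiple of the inverse, and `s` tends to `0`. -/
theorem dotProduct_adjugate_nonneg {ι : Type*} [Fintype ι] [DecidableEq ι] {A : Matrix ι ι ℝ}
    (hA : A.PosSemidef) (y : ι → ℝ) : 0 ≤ y ⬝ᵥ A.adjugate.mulVec y := by
  have hpos : ∀ s : ℝ, 0 < s → 0 ≤ y ⬝ᵥ (A + s • (1 : Matrix ι ι ℝ)).adjugate.mulVec y := by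
    intro s hs
    have hB : (A + s • (1 : Matrix ι ι ℝ)).PosDef := (Matrix.PosDef.one.smul hs).posSemidef_add hA
    have hdet := hB.det_pos
    have e : (A + s • (1 : Matrix ι ι ℝ)).adjugate
        = (A + s • (1 : Matrix ι ι ℝ)).det • (A + s • (1 : Matrix ι ι ℝ))⁻¹ := by
      rw [Matrix.inv_def, smul_smul, Ring.inverse_eq_inv', mul_inv_cancel₀ hdet.ne', one_smul]
    rw [e, Matrix.smul_mulVec, dotProduct_smul]
    exact mul_nonneg hdet.le (by simpa using hB.inv.posSemidef.dotProduct_mulVec_nonneg y)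
  have hcont : Continuous fun s : ℝ => y ⬝ᵥ (A + s • (1 : Matrix ι ι ℝ)).adjugate.mulVec y :=
    continuous_const.dotProduct (Continuous.matrix_mulVec
      (Continuous.matrix_adjugate (by fun_prop)) continuous_const)
  have hlim : Tendsto (fun s : ℝ => y ⬝ᵥ (A + s • (1 : Matrix ι ι ℝ)).adjugate.mulVec y)
      (𝓝[>] 0) (𝓝 (y ⬝ᵥ A.adjugate.mulVec y)) := by
    simpa using (hcont.tendsto 0).mono_left nhdsWithin_le_nhds
  exact ge_of_tendsto hlim (by filter_upwards [self_mem_nhdsWithin] with s hs using hpos s hs)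

/-- The cofactor matrix of the Hessian of a convex function is positive semidefinite almost
everywhere. -/
theorem cof_nonneg (hΩ : IsOpen Ω) [IsFiniteMeasure (vol Ω)] {u : H1 Ω}
    {σ : Matrix (Fin n) (Fin n) (H1 Ω)} (hσ : IsWeakHessian u σ) (hsymm : σ.IsSymm)
    {u' : Rn n → ℝ} (hu : val u =ᵐ[vol Ω] u') (hconv : ConvexOn ℝ Ω u') :
    ∀ᵐ x ∂(vol Ω), ∀ ξ : Rn n, 0 ≤ ∑ i, ∑ j, cof σ x i j * ξ j * ξ i := by
  filter_upwards [hessian_nonneg hΩ hσ hu hconv] with x hx ξ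
  have hs : (matVal σ x).IsSymm := by
    ext i j
    simp only [matVal, Matrix.transpose_apply, Matrix.of_apply]
    rw [hsymm.apply]
  have hpsd : (matVal σ x).PosSemidef := by
    refine Matrix.PosSemidef.of_dotProduct_mulVec_nonneg
      (by simpa [Matrix.IsHermitian] using hs.eq) fun y => ?_
    refine (hx (WithLp.toLp 2 y)).trans_eq ?_
    simp only [dotProduct, Matrix.mulVec, Finset.mul_sum, matVal, Matrix.of_apply]
    exact Finset.sum_congr rfl fun i _ => Finset.sum_congr rfl fun j _ => by simp; ring
  refine (dotProduct_adjugate_nonneg hpsd (fun i => ξ i)).trans_eq ?_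
  have hc : cof σ x = (matVal σ x).adjugate := by rw [cof, Matrix.adjugate_transpose, hs.eq]
  rw [hc]
  simp only [dotProduct, Matrix.mulVec, Finset.mul_sum]
  exact Finset.sum_congr rfl fun i _ => Finset.sum_congr rfl fun j _ => by ring

/-! ### The bilinear forms -/

theorem matInner_eq_sum_inner (χ μ : Matrix (Fin n) (Fin n) (H1 Ω)) :
    matInner χ μ = ∑ i, ∑ j, inner ℝ (χ i j).1.fst (μ i j).1.fst := by
  have hi : ∀ i j, Integrable (fun x => val (χ i j) x * val (μ i j) x) (vol Ω) := fun i j =>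
    (memLp_val (χ i j)).integrable_mul (memLp_val (μ i j))
  rw [matInner, integral_finsetSum _ fun i _ => integrable_finsetSum _ fun j _ => hi i j]
  refine Finset.sum_congr rfl fun i _ => ?_
  rw [integral_finsetSum _ fun j _ => hi i j]
  exact Finset.sum_congr rfl fun j _ => integral_mul_val_eq_inner _ _

/-- `matInner` as a bilinear form. -/
noncomputable def matForm (Ω : Set (Rn n)) :
    Matrix (Fin n) (Fin n) (H1 Ω) →ₗ[ℝ] Matrix (Fin n) (Fin n) (H1 Ω) →ₗ[ℝ] ℝ :=
  LinearMap.mk₂ ℝ matInner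
    (fun χ χ' μ => by simp [matInner_eq_sum_inner, inner_add_left, Finset.sum_add_distrib])
    (fun c χ μ => by simp [matInner_eq_sum_inner, inner_smul_left, Finset.mul_sum])
    (fun χ μ μ' => by simp [matInner_eq_sum_inner, inner_add_right, Finset.sum_add_distrib])
    (fun c χ μ => by simp [matInner_eq_sum_inner, inner_smul_right, Finset.mul_sum])

theorem matInner_self_nonneg (χ : Matrix (Fin n) (Fin n) (H1 Ω)) : 0 ≤ matInner χ χ := by
  rw [matInner_eq_sum_inner]
  exact Finset.sum_nonneg fun i _ => Finset.sum_nonneg fun j _ => real_inner_self_nonneg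

theorem eq_zero_of_matInner_self (hΩ : IsOpen Ω) [IsFiniteMeasure (vol Ω)]
    {χ : Matrix (Fin n) (Fin n) (H1 Ω)} (h : matInner χ χ = 0) : χ = 0 := by
  rw [matInner_eq_sum_inner, Finset.sum_eq_zero_iff_of_nonneg fun i _ =>
    Finset.sum_nonneg fun j _ => real_inner_self_nonneg] at h
  ext1 i j
  have h1 := h i (Finset.mem_univ i)
  rw [Finset.sum_eq_zero_iff_of_nonneg fun j _ => real_inner_self_nonneg] at h1
  have h2 := inner_self_eq_zero.1 (h1 j (Finset.mem_univ j))
  exact eq_zero_of_val hΩ ((Lp.eq_zero_iff_ae_eq_zero).1 h2)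

theorem integrable_divInner (μ : Matrix (Fin n) (Fin n) (H1 Ω)) (v : H1 Ω) :
    Integrable (fun x => ∑ i, matDiv μ x i * grad v x i) (vol Ω) :=
  integrable_finsetSum _ fun i _ => MemLp.integrable_mul
    (memLp_finsetSum _ fun j _ => memLp_grad (μ i j) j) (memLp_grad v i)

theorem matDiv_add (μ μ' : Matrix (Fin n) (Fin n) (H1 Ω)) :
    ∀ᵐ x ∂(vol Ω), ∀ i, matDiv (μ + μ') x i = matDiv μ x i + matDiv μ' x i := by
  filter_upwards [ae_all_iff.2 fun i => ae_all_iff.2 fun j => grad_add (μ i j) (μ' i j)] with x hx i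
  simp [matDiv, hx, Finset.sum_add_distrib]

theorem matDiv_smul (c : ℝ) (μ : Matrix (Fin n) (Fin n) (H1 Ω)) :
    ∀ᵐ x ∂(vol Ω), ∀ i, matDiv (c • μ) x i = c * matDiv μ x i := by
  filter_upwards [ae_all_iff.2 fun i => ae_all_iff.2 fun j => grad_smul c (μ i j)] with x hx i
  simp [matDiv, hx, Finset.mul_sum]

/-- `divInner` as a bilinear form. -/
noncomputable def divForm (Ω : Set (Rn n)) :
    Matrix (Fin n) (Fin n) (H1 Ω) →ₗ[ℝ] H1 Ω →ₗ[ℝ] ℝ :=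
  LinearMap.mk₂ ℝ divInner
    (fun μ μ' v => by
      rw [divInner, divInner, divInner,
        ← integral_add (integrable_divInner μ v) (integrable_divInner μ' v)]
      apply integral_congr_ae
      filter_upwards [matDiv_add μ μ'] with x hx
      simp [hx, add_mul, Finset.sum_add_distrib])
    (fun c μ v => by
      rw [divInner, divInner, smul_eq_mul, ← integral_const_mul]
      apply integral_congr_ae
      filter_upwards [matDiv_smul c μ] with x hx
      simp [hx, mul_assoc, Finset.mul_sum])
    (fun μ v v' => by
      rw [divInner, divInner, divInner,
        ← integral_add (integrable_divInner μ v) (integrable_divInner μ v')]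
      apply integral_congr_ae
      filter_upwards [grad_add v v'] with x hx
      simp [hx, mul_add, Finset.sum_add_distrib])
    (fun c μ v => by
      rw [divInner, divInner, smul_eq_mul, ← integral_const_mul]
      apply integral_congr_ae
      filter_upwards [grad_smul c v] with x hx
      simp [hx, mul_left_comm, Finset.mul_sum])

/-- Testing the divergence against isotropic fields recovers the Dirichlet form. -/
theorem divInner_diagonal (v w : H1 Ω) :
    divInner (Matrix.diagonal fun _ => v) w = ∫ x in Ω, ∑ i, grad v x i * grad w x i := by
  apply integral_congr_ae
  filter_upwards [grad_zero (Ω := Ω)] with x hx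
  refine Finset.sum_congr rfl fun i _ => ?_
  congr 1
  rw [matDiv, Finset.sum_eq_single i]
  · simp
  · intro j _ hj
    rw [Matrix.diagonal_apply_ne _ hj.symm, hx]
    rfl
  · simp

theorem grad_ae_eq_zero_of_integral {w : H1 Ω}
    (h : ∫ x in Ω, ∑ i, grad w x i * grad w x i = 0) : grad w =ᵐ[vol Ω] 0 := by
  have hi : Integrable (fun x => ∑ i, grad w x i * grad w x i) (vol Ω) :=
    integrable_finsetSum _ fun i _ => (memLp_grad w i).integrable_mul (memLp_grad w i)
  have h0 := (integral_eq_zero_iff_of_nonneg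
    (fun x => Finset.sum_nonneg fun i _ => mul_self_nonneg _) hi).1 h
  filter_upwards [h0] with x hx
  ext i
  have := (Finset.sum_eq_zero_iff_of_nonneg fun i _ => mul_self_nonneg (grad w x i)).1 hx i
    (Finset.mem_univ i)
  simpa using this

/-- For `n ≤ 3` the cofactors are polynomials of degree at most two in the entries, hence
integrable when the entries are in `L²`. -/
theorem integrable_cof (hn : n = 2 ∨ n = 3) [IsFiniteMeasure (vol Ω)]
    (σ : Matrix (Fin n) (Fin n) (H1 Ω)) (i j : Fin n) :
    Integrable (fun x => cof σ x i j) (vol Ω) := by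
  have h1 : ∀ i j, Integrable (fun x => val (σ i j) x) (vol Ω) := fun i j =>
    (memLp_val (σ i j)).integrable (by norm_num)
  have h2 : ∀ i j k l, Integrable (fun x => val (σ i j) x * val (σ k l) x) (vol Ω) :=
    fun i j k l => (memLp_val (σ i j)).integrable_mul (memLp_val (σ k l))
  rcases hn with rfl | rfl
  · fin_cases i <;> fin_cases j <;> simp [cof, Matrix.adjugate_fin_two, matVal, h1]
  · have h3 : ∀ i j k l i' j' k' l', Integrable (fun x =>
        val (σ i j) x * val (σ k l) x - val (σ i' j') x * val (σ k' l') x) (vol Ω) :=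
      fun i j k l i' j' k' l' => (h2 i j k l).sub (h2 i' j' k' l')
    have h4 : ∀ i j k l i' j' k' l', Integrable (fun x =>
        -(val (σ i j) x * val (σ k l) x) + val (σ i' j') x * val (σ k' l') x) (vol Ω) :=
      fun i j k l i' j' k' l' => (h2 i j k l).neg.add (h2 i' j' k' l')
    fin_cases i <;> fin_cases j <;> simp [cof, Matrix.adjugate_fin_three, matVal, h3, h4]

theorem integrable_coeffInner {A : Rn n → Matrix (Fin n) (Fin n) ℝ}
    (hA : ∀ i j, Integrable (fun x => A x i j) (vol Ω)) {w v : H1 Ω}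
    (hw : ∃ C : ℝ, ∀ᵐ x ∂(vol Ω), ∀ i, ‖grad w x i‖ ≤ C)
    (hv : ∃ C : ℝ, ∀ᵐ x ∂(vol Ω), ∀ i, ‖grad v x i‖ ≤ C) :
    Integrable (fun x => ∑ i, ∑ j, A x i j * grad w x j * grad v x i) (vol Ω) := by
  obtain ⟨C, hC⟩ := hw
  obtain ⟨D, hD⟩ := hv
  exact integrable_finsetSum _ fun i _ => integrable_finsetSum _ fun j _ =>
    ((hA i j).mul_bdd (c := C) (memLp_grad w j).1 (hC.mono fun x hx => hx j)).mul_bdd (c := D)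
      (memLp_grad v i).1 (hD.mono fun x hx => hx i)

theorem coeffInner_add_left {A : Rn n → Matrix (Fin n) (Fin n) ℝ}
    (hA : ∀ i j, Integrable (fun x => A x i j) (vol Ω)) {w w' v : H1 Ω}
    (hw : ∃ C : ℝ, ∀ᵐ x ∂(vol Ω), ∀ i, ‖grad w x i‖ ≤ C)
    (hw' : ∃ C : ℝ, ∀ᵐ x ∂(vol Ω), ∀ i, ‖grad w' x i‖ ≤ C)
    (hv : ∃ C : ℝ, ∀ᵐ x ∂(vol Ω), ∀ i, ‖grad v x i‖ ≤ C) :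
    coeffInner A (w + w') v = coeffInner A w v + coeffInner A w' v := by
  rw [coeffInner, coeffInner, coeffInner, ← integral_add (integrable_coeffInner hA hw hv)
    (integrable_coeffInner hA hw' hv)]
  apply integral_congr_ae
  filter_upwards [grad_add w w'] with x hx
  simp only [hx, Pi.add_apply, PiLp.add_apply, mul_add, add_mul, Finset.sum_add_distrib]

theorem coeffInner_add_right {A : Rn n → Matrix (Fin n) (Fin n) ℝ}
    (hA : ∀ i j, Integrable (fun x => A x i j) (vol Ω)) {w v v' : H1 Ω}
    (hw : ∃ C : ℝ, ∀ᵐ x ∂(vol Ω), ∀ i, ‖grad w x i‖ ≤ C)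
    (hv : ∃ C : ℝ, ∀ᵐ x ∂(vol Ω), ∀ i, ‖grad v x i‖ ≤ C)
    (hv' : ∃ C : ℝ, ∀ᵐ x ∂(vol Ω), ∀ i, ‖grad v' x i‖ ≤ C) :
    coeffInner A w (v + v') = coeffInner A w v + coeffInner A w v' := by
  rw [coeffInner, coeffInner, coeffInner, ← integral_add (integrable_coeffInner hA hw hv)
    (integrable_coeffInner hA hw hv')]
  apply integral_congr_ae
  filter_upwards [grad_add v v'] with x hx
  simp only [hx, Pi.add_apply, PiLp.add_apply, mul_add, Finset.sum_add_distrib]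

theorem coeffInner_smul_left (A : Rn n → Matrix (Fin n) (Fin n) ℝ) (c : ℝ) (w v : H1 Ω) :
    coeffInner A (c • w) v = c * coeffInner A w v := by
  rw [coeffInner, coeffInner, ← integral_const_mul]
  apply integral_congr_ae
  filter_upwards [grad_smul c w] with x hx
  simp only [hx, Pi.smul_apply, PiLp.smul_apply, smul_eq_mul, Finset.mul_sum]
  exact Finset.sum_congr rfl fun i _ => Finset.sum_congr rfl fun j _ => by ring

theorem coeffInner_smul_right (A : Rn n → Matrix (Fin n) (Fin n) ℝ) (c : ℝ) (w v : H1 Ω) :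
    coeffInner A w (c • v) = c * coeffInner A w v := by
  rw [coeffInner, coeffInner, ← integral_const_mul]
  apply integral_congr_ae
  filter_upwards [grad_smul c v] with x hx
  simp only [hx, Pi.smul_apply, PiLp.smul_apply, smul_eq_mul, Finset.mul_sum]
  exact Finset.sum_congr rfl fun i _ => Finset.sum_congr rfl fun j _ => by ring

/-- `coeffInner` as a bilinear form on a space of functions with bounded gradients. The bound on
the gradients is what makes the form additive: the coefficient matrix is merely integrable, and on
all of `H¹` the defining integral could take its junk value. -/
noncomputable def coeffForm {A : Rn n → Matrix (Fin n) (Fin n) ℝ}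
    (hA : ∀ i j, Integrable (fun x => A x i j) (vol Ω)) (Y : Submodule ℝ (H1 Ω))
    (hY : ∀ v ∈ Y, ∃ C : ℝ, ∀ᵐ x ∂(vol Ω), ∀ i, ‖grad v x i‖ ≤ C) : Y →ₗ[ℝ] Y →ₗ[ℝ] ℝ :=
  LinearMap.mk₂ ℝ (fun w v => coeffInner A w.1 v.1)
    (fun w w' v => coeffInner_add_left hA (hY _ w.2) (hY _ w'.2) (hY _ v.2))
    (fun c w v => coeffInner_smul_left A c w.1 v.1)
    (fun w v v' => coeffInner_add_right hA (hY _ w.2) (hY _ v.2) (hY _ v'.2))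
    (fun c w v => coeffInner_smul_right A c w.1 v.1)

/-! ### Finite-dimensional saddle point problems -/

/-- A finite-dimensional saddle point problem with a positive definite form `a`, a nonnegative
form `c` and a coupling form `b` without kernel on the second factor is uniquely solvable. -/
theorem existsUnique_saddlePoint {X Y : Type*} [AddCommGroup X] [Module ℝ X]
    [FiniteDimensional ℝ X] [AddCommGroup Y] [Module ℝ Y] [FiniteDimensional ℝ Y]
    (a : X →ₗ[ℝ] X →ₗ[ℝ] ℝ) (b : X →ₗ[ℝ] Y →ₗ[ℝ] ℝ) (c : Y →ₗ[ℝ] Y →ₗ[ℝ] ℝ)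
    (ha : ∀ x, 0 ≤ a x x) (ha' : ∀ x, a x x = 0 → x = 0) (hc : ∀ y, 0 ≤ c y y)
    (hb : ∀ y, (∀ x, b x y = 0) → y = 0) (ℓ : Y →ₗ[ℝ] ℝ) :
    ∃! p : X × Y, (∀ x, a p.1 x + b x p.2 = 0) ∧ ∀ y, b p.1 y - c p.2 y = ℓ y := by
  let L : X × Y →ₗ[ℝ] Module.Dual ℝ X × Module.Dual ℝ Y :=
    LinearMap.prod (LinearMap.coprod a b.flip) (LinearMap.coprod b (-c))
  have hL1 : ∀ p x, (L p).1 x = a p.1 x + b x p.2 := fun p x => by simp [L]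
  have hL2 : ∀ p y, (L p).2 y = b p.1 y - c p.2 y := fun p y => by simp [L, sub_eq_add_neg]
  have hinj : Function.Injective L := by
    refine (injective_iff_map_eq_zero _).2 fun p hp => ?_
    have h1 : ∀ x, a p.1 x + b x p.2 = 0 := fun x => by rw [← hL1, hp]; rfl
    have h2 : ∀ y, b p.1 y - c p.2 y = 0 := fun y => by rw [← hL2, hp]; rfl
    have h3 : p.1 = 0 := ha' _ (by linarith [h1 p.1, h2 p.2, ha p.1, hc p.2])
    have h4 : p.2 = 0 := hb _ fun x => by simpa [h3] using h1 x
    exact Prod.ext h3 h4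
  have hsurj : Function.Surjective L :=
    (LinearMap.injective_iff_surjective_of_finrank_eq_finrank
      (by simp [Module.finrank_prod, Subspace.dual_finrank_eq])).1 hinj
  obtain ⟨p, hp⟩ := hsurj (0, ℓ)
  refine ⟨p, ⟨fun x => by rw [← hL1, hp]; rfl, fun y => by rw [← hL2, hp]⟩, ?_⟩
  rintro p' ⟨h1, h2⟩
  refine hinj (hp.symm ▸ Prod.ext ?_ ?_)
  · ext x
    rw [hL1, h1]
    rfl
  · ext y
    rw [hL2, h2]

/-! ### The discrete linearized problem -/

/-- `W₀^h` as a linear space. -/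
noncomputable def W0hSpace (kind : MeshKind) (Ω : Set (Rn n)) (T : Finset (Set (Rn n))) (k : ℕ) :
    Submodule ℝ (Matrix (Fin n) (Fin n) (H1 Ω)) :=
  (VhSpace kind Ω T k).matrix ⊓ WZero Ω

/-- `V₀^h` as a linear space. -/
noncomputable def V0hSpace (kind : MeshKind) (Ω : Set (Rn n)) (T : Finset (Set (Rn n))) (k : ℕ) :
    Submodule ℝ (H1 Ω) :=
  VhSpace kind Ω T k ⊓ H10 Ω

theorem finite_W0hSpace {kind : MeshKind} {T : Finset (Set (Rn n))} {k : ℕ}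
    [Module.Finite ℝ (VhSpace kind Ω T k)] : Module.Finite ℝ (W0hSpace kind Ω T k) := by
  let e : W0hSpace kind Ω T k →ₗ[ℝ] (Fin n → Fin n → VhSpace kind Ω T k) :=
    { toFun := fun μ i j => ⟨μ.1 i j, μ.2.1 i j⟩
      map_add' := fun _ _ => rfl
      map_smul' := fun _ _ => rfl }
  refine Module.Finite.of_injective e fun μ μ' h => ?_
  ext1
  ext1 i j
  exact congrArg Subtype.val (congrFun (congrFun h i) j)

end MongeAmpereFEM

open MongeAmpereFEM
theorem theorem3p1 (n : ℕ) (hn : n = 2 ∨ n = 3)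
    (Ω : Set (Rn n)) (hΩ_open : IsOpen Ω) (hΩ_ne : Ω.Nonempty)
    (hΩ_bdd : Bornology.IsBounded Ω) (hΩ_conv : Convex ℝ Ω)
    (ε : ℝ) (hε : 0 < ε)
    (f g : Rn n → ℝ) (hf : MemLp f 2 (vol Ω)) (hf_pos : ∀ᵐ x ∂(vol Ω), 0 < f x)
    (u : H1 Ω) (σ : Matrix (Fin n) (Fin n) (H1 Ω))
    (hu : IsStrictlyConvexSolution Ω ε f g u σ)
    (kind : MeshKind) (T : Finset (Set (Rn n))) (hT : IsMesh kind Ω T)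
    (k : ℕ) (hk : 2 ≤ k)
    (q : StrongDual ℝ (H10 Ω)) :
    ∃! p : Matrix (Fin n) (Fin n) (H1 Ω) × H1 Ω,
      IsDiscreteSolution kind Ω T k ε (cof σ) q p.1 p.2 := by
  have hfin : IsFiniteMeasure (vol Ω) := ⟨by simpa using hΩ_bdd.measure_lt_top⟩
  have hV : Module.Finite ℝ (VhSpace kind Ω T k) := finite_VhSpace hΩ_open hΩ_ne hT k
  have hX : Module.Finite ℝ (W0hSpace kind Ω T k) := finite_W0hSpace
  have hY : Module.Finite ℝ (V0hSpace kind Ω T k) :=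
    Submodule.finiteDimensional_of_le (S₂ := VhSpace kind Ω T k) inf_le_left
  obtain ⟨u', hu', hconv⟩ := hu.strictConvex
  have hcof := cof_nonneg hΩ_open hu.hessian hu.boundary_hess.1 hu' hconv.convexOn
  have hi : Fin n := ⟨0, by omega⟩
  let a := (matForm Ω).domRestrict₁₂ (W0hSpace kind Ω T k) (W0hSpace kind Ω T k)
  let b := (divForm Ω).domRestrict₁₂ (W0hSpace kind Ω T k) (V0hSpace kind Ω T k)
  let c := (1 / ε) • coeffForm (integrable_cof hn σ) (V0hSpace kind Ω T k)
    fun v hv => exists_bound_grad hΩ_open hΩ_bdd hT hv.1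
  let ℓ : V0hSpace kind Ω T k →ₗ[ℝ] ℝ :=
    q.toLinearMap.comp ((V0hSpace kind Ω T k).subtype.codRestrict (H10 Ω) fun v => v.2.2)
  have key := existsUnique_saddlePoint a b c (fun x => matInner_self_nonneg x.1)
    (fun x hx => Subtype.ext (eq_zero_of_matInner_self hΩ_open hx)) (fun y => ?_)
    (fun y hy => ?_) ℓ
  · obtain ⟨p, ⟨h1, h2⟩, hp⟩ := key
    refine ⟨(p.1.1, p.2.1), ⟨p.1.2, p.2.2, fun μ hμ => h1 ⟨μ, hμ⟩, fun v hv => h2 ⟨v, hv⟩⟩, ?_⟩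
    rintro ⟨χ, w⟩ ⟨hχ, hw, e1, e2⟩
    have := hp (⟨χ, hχ⟩, ⟨w, hw⟩) ⟨fun μ => e1 μ.1 μ.2, fun v => e2 v.1 v.2⟩
    rw [← this]
  · have h0 : 0 ≤ coeffInner (cof σ) y.1 y.1 := by
      refine integral_nonneg_of_ae ?_
      filter_upwards [hcof] with x hx using hx _
    exact mul_nonneg (by positivity) h0
  -- if `b` annihilates `y` it does so on the isotropic field `y I`, whose divergence is `Dy`
  · have hmem : (Matrix.diagonal fun _ => y.1) ∈ W0hSpace kind Ω T k := by
      refine ⟨fun i j => ?_, scalar_mem_W hΩ_open y.2.2⟩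
      by_cases hij : i = j
      · subst hij
        simpa using y.2.1
      · rw [Matrix.diagonal_apply_ne _ hij]
        exact zero_mem _
    have h0 : divInner (Matrix.diagonal fun _ => y.1) y.1 = 0 := hy ⟨_, hmem⟩
    rw [divInner_diagonal] at h0
    exact Subtype.ext (eq_zero_of_mem_H10_of_grad hΩ_open hΩ_bdd hi y.2.2
      (grad_ae_eq_zero_of_integral h0))
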